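/- Notation. $B(\zeta,r)$ and $B^0(\zeta,r)$ are the open and the punctured open disc. For $M>0$ let $\Omega_+=\{\eta\in\mathbb C: M\le|\eta|\le 2M,\ 0\le\arg\eta\le\pi\}$. Let $S_\eta(t)=-i\left[\ln t+\ln(1-t)-\ln(1-t/\eta)\right]$ with principal logarithms (that is, $-i\ln\frac{t(1-t)}{1-t/\eta}$ with cuts $(-\infty,0)$, $(1,\infty)$ and the ray from $\eta$ to $\infty$ with angle $\arg\eta$), and let $t_-^*(\eta)=\eta-\sqrt{\eta^2-\eta}$, where the root has branch cut $[0,1]$ and is $\sim\eta$ at infinity. Let $a(\lambda)=\frac1{i\pi}\ln\frac{i+\sqrt{4\lambda^2-1}}{2\lambda}$, where $\ln$ is principal and $\sqrt{4\lambda^2-1}\sim2\lambda$ at infinity has branch cut $[-\frac12,\frac12]$; for real $\lambda\ne0$ in $(-\frac12,\frac12)$, $a(\lambda)$ stands for either of the two boundary values $a_\pm(\lambda)$ from the upper and lower half plane. Theorem. There is $M_0>0$ such that the following holds for all $M\ge M_0$ and $\epsilon>0$. Let $F(t,\eta,\lambda)$ be a complex-valued function such that 1. for every $(\eta,\lambda)\in\Omega_+\times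 B^0(0,\epsilon)$, $F(\cdot,\eta,\lambda)$ is analytic in $B(\frac12,\frac12)$; 2. $F$ is continuous on $B(\frac12,\frac12)\times\Omega_+\times B^0(0,\epsilon)$, and for every $r\in(0,\frac12)$ there is a constant $K(r)$ with $|F(t,\eta,\lambda)|\le K(r)$ for $|t-\frac12|\le r$ and all $(\eta,\lambda)\in\Omega_+\times B^0(0,\epsilon)$; 3. $|F(t,\eta,\lambda)|\le A_0|t|^{c_0}$ for $t\in B(\frac12,\frac12)$, $|t|<\rho$, and all $(\eta,\lambda)\in\Omega_+\times B^0(0,\epsilon)$, where $c_0>-1$ and $\rho>0$; 4. $|F(t,\eta,\lambda)|\le A_1|1-t|^{c_1}$ for $t\in B(\frac12,\frac12)$, $|1-t|<\rho$, and all $(\eta,\lambda)\in\Omega_+\times B^0(0,\epsilon)$, where $c_1>-1$; 5. $|F(t_-^*(\eta),\eta,\lambda)|\ge m>0$ for all $(\eta,\lambda)\in\Omega_+\times B^0(0,\epsilon)$. Then, as $\lambda\to0$, the integral below converges absolutely and $$\int_0^1F(t,\eta,\lambda)e^{-\operatorname{Im}[a(\lambda)]S_\eta(t)}\,dt=e^{-\operatorname{Im}[a(\lambda)]S_\eta(t_-^*(\eta))}F(t_-^*(\eta),\eta,\lambda)\sqrt{\frac{2\pi}{\operatorname{Im}[a(\lambda)]\,S_\eta''(t_-^*(\eta))}}\left[1+O\!\left(\frac{M^2}{\operatorname{Im}[a(\lambda)]}\right)\right]$$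 with the principal square root, uniformly for $\eta\in\Omega_+$. More precisely, there are $C,\delta>0$, depending only on $c_0,c_1,A_0,A_1,\rho,m$ and $K(\cdot)$ (not on $M$, $\epsilon$, $F$, $\eta$ or $\lambda$), such that for all $\eta\in\Omega_+$ and all $\lambda\in B^0(0,\epsilon)$ with $|\lambda|<\delta$ the bracket is $1+E$ with $|E|\le C M^2/|\operatorname{Im}a(\lambda)|$. -/

import Mathlib

open Filter Topology

namespace SaddlePoint

noncomputable section

/-- `√(4λ² - 1)` with branch cut `[-1/2, 1/2]`, normalised by `√(4λ² - 1) ~ 2λ` at infinity. -/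
def sqrtFour (lam : ℂ) : ℂ :=
  (2 * lam - 1) ^ (1 / 2 : ℂ) * (2 * lam + 1) ^ (1 / 2 : ℂ)

/-- `a(λ) = (1 / (iπ)) ln ((i + √(4λ² - 1)) / (2λ))`, analytic off `[-1/2, 1/2]`. -/
def aFun (lam : ℂ) : ℂ :=
  1 / (Complex.I * Real.pi) * Complex.log ((Complex.I + sqrtFour lam) / (2 * lam))

/-- `α` is the value of `a` at `λ`, approached from the closed half plane(s) containing `λ`.
For `λ` not real this says `α = a(λ)`; for real `λ` in `(-1/2, 1/2)`, `λ ≠ 0`, the two possible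
`α` are the boundary values `a₊(λ)` and `a₋(λ)` on the upper and lower shores of the cut. -/
def IsValueOfA (lam α : ℂ) : Prop :=
  (0 ≤ lam.im ∧ Tendsto aFun (𝓝[{z : ℂ | 0 < z.im}] lam) (𝓝 α)) ∨
  (lam.im ≤ 0 ∧ Tendsto aFun (𝓝[{z : ℂ | z.im < 0}] lam) (𝓝 α))

/-- `S_η(t) = -i ln (t (1 - t) / (1 - t/η))`, with branch cuts in `t` equal to `(-∞, 0)`, `(1, ∞)`
and the ray from `η` to infinity with angle `arg η`. -/
def S (η t : ℂ) : ℂ :=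
  -Complex.I * (Complex.log t + Complex.log (1 - t) - Complex.log (1 - t / η))

/-- The saddle point `t₋*(η) = η - √(η² - η)`, the root having branch cut `[0, 1]` and being
`~ η` at infinity. -/
def tMinus (η : ℂ) : ℂ :=
  η - η ^ (1 / 2 : ℂ) * (η - 1) ^ (1 / 2 : ℂ)

/-- The closed half annulus `Ω₊`. -/
def OmegaPlus (M : ℝ) : Set ℂ :=
  {η | M ≤ ‖η‖ ∧ ‖η‖ ≤ 2 * M ∧ 0 ≤ η.arg ∧ η.arg ≤ Real.pi}

/-- The open disc `B(1/2, 1/2)`. -/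
def disc : Set ℂ := Metric.ball (1 / 2 : ℂ) (1 / 2)

/-- The punctured open disc `B⁰(0, ε)`. -/
def puncturedDisc (ε : ℝ) : Set ℂ := Metric.ball (0 : ℂ) ε \ {0}

/-- The hypotheses on the amplitude `F`, with the constants in the bounds displayed:
`K r` bounds `F` for `|t - 1/2| ≤ r`; `A₀`, `c₀` and `A₁`, `c₁` are the constants and exponents
in the bounds for `|t| < ρ` and `|1 - t| < ρ`; `m` is the lower bound at the saddle point. -/
structure IsAdmissible (M ε c₀ c₁ A₀ A₁ ρ m : ℝ) (K : ℝ → ℝ) (F : ℂ → ℂ → ℂ → ℂ) : Prop where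
  analytic : ∀ η ∈ OmegaPlus M, ∀ lam ∈ puncturedDisc ε,
    AnalyticOnNhd ℂ (fun t => F t η lam) disc
  continuous : ContinuousOn (fun p : ℂ × ℂ × ℂ => F p.1 p.2.1 p.2.2)
    (disc ×ˢ (OmegaPlus M ×ˢ puncturedDisc ε))
  bounded : ∀ r : ℝ, 0 < r → r < 1 / 2 → ∀ t ∈ Metric.closedBall (1 / 2 : ℂ) r,
    ∀ η ∈ OmegaPlus M, ∀ lam ∈ puncturedDisc ε, ‖F t η lam‖ ≤ K r
  at_zero : ∀ t ∈ disc, ‖t‖ < ρ →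
    ∀ η ∈ OmegaPlus M, ∀ lam ∈ puncturedDisc ε, ‖F t η lam‖ ≤ A₀ * ‖t‖ ^ c₀
  at_one : ∀ t ∈ disc, ‖1 - t‖ < ρ →
    ∀ η ∈ OmegaPlus M, ∀ lam ∈ puncturedDisc ε, ‖F t η lam‖ ≤ A₁ * ‖1 - t‖ ^ c₁
  separated : ∀ η ∈ OmegaPlus M, ∀ lam ∈ puncturedDisc ε, m ≤ ‖F (tMinus η) η lam‖

/-- The integrand `F(t, η, λ) e^{- Im[a] S_η(t)}`, for the value `α` of `a(λ)`. -/
def integrand (F : ℂ → ℂ → ℂ → ℂ) (η lam α : ℂ) (t : ℝ) : ℂ :=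
  F t η lam * Complex.exp (-(α.im : ℂ) * S η t)

/-- The saddle point contribution (principal square root), for the value `α` of `a(λ)`. -/
def saddleContribution (F : ℂ → ℂ → ℂ → ℂ) (η lam α : ℂ) : ℂ :=
  Complex.exp (-(α.im : ℂ) * S η (tMinus η)) * F (tMinus η) η lam *
    (2 * Real.pi / (α.im * iteratedDeriv 2 (S η) (tMinus η))) ^ (1 / 2 : ℂ)

end

end SaddlePoint

namespace SaddlePoint

/-! ### Principal square roots -/

theorem cpow_half_sq (z : ℂ) : (z ^ (1 / 2 : ℂ)) ^ 2 = z := by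
  simp [one_div]

theorem cpow_half_re_nonneg (z : ℂ) : 0 ≤ (z ^ (1 / 2 : ℂ)).re := by
  rcases eq_or_ne z 0 with rfl | hz
  · simp
  · rw [Complex.cpow_def_of_ne_zero hz, Complex.exp_re]
    refine mul_nonneg (Real.exp_pos _).le (Real.cos_nonneg_of_mem_Icc ?_)
    have h : (Complex.log z * (1 / 2 : ℂ)).im = z.arg / 2 := by
      simp [Complex.mul_im, Complex.log_im]; ring
    rw [h]
    constructor <;> linarith [Complex.neg_pi_lt_arg z, Complex.arg_le_pi z]

theorem cpow_half_im_nonneg {z : ℂ} (hz : 0 ≤ z.arg) : 0 ≤ (z ^ (1 / 2 : ℂ)).im := by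
  rcases eq_or_ne z 0 with rfl | hz0
  · simp
  · rw [Complex.cpow_def_of_ne_zero hz0, Complex.exp_im]
    refine mul_nonneg (Real.exp_pos _).le (Real.sin_nonneg_of_nonneg_of_le_pi ?_ ?_)
    all_goals
      have h : (Complex.log z * (1 / 2 : ℂ)).im = z.arg / 2 := by
        simp [Complex.mul_im, Complex.log_im]; ring
      rw [h]
      linarith [Complex.arg_le_pi z, Real.pi_pos]

theorem eq_of_sq_eq_sq_of_re_pos {x y : ℂ} (h : x ^ 2 = y ^ 2) (hx : 0 < x.re)
    (hy : 0 ≤ y.re) : x = y := by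
  rcases sq_eq_sq_iff_eq_or_eq_neg.1 h with h | h
  · exact h
  · rw [h, Complex.neg_re] at hx
    linarith

/-- The principal square root is multiplicative for the factors `-2i` and `2i` on the right half
plane. -/
theorem mul_cpow_half_of_re_pos {σ : ℝ} (hσ : σ = 1 ∨ σ = -1) {Z : ℂ} (hZ : 0 < Z.re) :
    (1 - σ * Complex.I) * Z ^ (1 / 2 : ℂ) = (-2 * σ * Complex.I * Z) ^ (1 / 2 : ℂ) := by
  have hs := cpow_half_sq Z
  have hr := cpow_half_re_nonneg Z
  set Y := Z ^ (1 / 2 : ℂ) with hY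
  -- Since Re Y² > 0, |Im Y| < Re Y. Turning Y by an angle π/4 either way keeps it in the right half
  -- plane, so no branch is crossed.
  have hre : 0 < Y.re ^ 2 - Y.im ^ 2 := by
    rw [← hs] at hZ
    simpa [sq, Complex.mul_re] using hZ
  have hσ2 : σ ^ 2 = 1 := by rcases hσ with h | h <;> simp [h]
  apply eq_of_sq_eq_sq_of_re_pos
  · rw [cpow_half_sq, mul_pow, hs]
    have : (σ : ℂ) ^ 2 = 1 := by exact_mod_cast hσ2
    linear_combination (Z * Complex.I ^ 2) * this + Z * Complex.I_sq
  · have : ((1 - σ * Complex.I) * Y).re = Y.re + σ * Y.im := by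
      simp [Complex.mul_re]
    rw [this]
    rcases hσ with h | h <;> rw [h] <;> nlinarith
  · exact cpow_half_re_nonneg _

/-! ### The size of `Im a(λ)` -/

theorem sqrtFour_sq (z : ℂ) : sqrtFour z ^ 2 = 4 * z ^ 2 - 1 := by
  rw [sqrtFour, mul_pow, cpow_half_sq, cpow_half_sq]; ring

theorem aFun_im (z : ℂ) :
    (aFun z).im = -(Real.log ‖(Complex.I + sqrtFour z) / (2 * z)‖ / Real.pi) := by
  have h : aFun z = ((-(1 / Real.pi) : ℝ) : ℂ) *
      (Complex.I * Complex.log ((Complex.I + sqrtFour z) / (2 * z))) := by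
    have hpi : (Real.pi : ℂ) ≠ 0 := by exact_mod_cast Real.pi_ne_zero
    rw [aFun]
    push_cast
    generalize Complex.log ((Complex.I + sqrtFour z) / (2 * z)) = l
    field_simp
    linear_combination l * Complex.I_sq
  rw [h, Complex.im_ofReal_mul, Complex.I_mul_im, Complex.log_re]
  ring

/-- The argument W of the logarithm has inverse (s - i)/(2z), and W - W⁻¹ = i/z. A small z thus
forces |W| to be very large or very small, whichever branch s of the root is taken. -/
theorem one_le_abs_aFun_im {z : ℂ} (hz : z ≠ 0) (h : ‖z‖ < Real.exp (-4) / 2) :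
    1 ≤ |(aFun z).im| := by
  set s := sqrtFour z with hs
  set W := (Complex.I + s) / (2 * z) with hW
  have hs2 : s ^ 2 = 4 * z ^ 2 - 1 := sqrtFour_sq z
  have hWV : W * ((s - Complex.I) / (2 * z)) = 1 := by
    rw [hW]; field_simp; linear_combination hs2 - Complex.I_sq
  have hdiff : W - (s - Complex.I) / (2 * z) = Complex.I / z := by
    rw [hW]; field_simp; ring
  have hW0 : W ≠ 0 := left_ne_zero_of_mul_eq_one hWV
  have hV : (s - Complex.I) / (2 * z) = W⁻¹ := eq_inv_of_mul_eq_one_right hWV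
  rw [hV] at hdiff
  have hzpos : 0 < ‖z‖ := norm_pos_iff.2 hz
  have hbig : 2 * Real.exp 4 < ‖W‖ + ‖W‖⁻¹ := by
    calc 2 * Real.exp 4 < ‖z‖⁻¹ := by
          rw [lt_inv_comm₀ (by positivity) hzpos]
          refine h.trans_eq ?_
          rw [Real.exp_neg, mul_inv]; ring
      _ = ‖W - W⁻¹‖ := by rw [hdiff, norm_div, Complex.norm_I, one_div]
      _ ≤ ‖W‖ + ‖W‖⁻¹ := (norm_sub_le _ _).trans (by rw [norm_inv])
  have hWp : 0 < ‖W‖ := norm_pos_iff.2 hW0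
  -- The exponent 4 is chosen because 4 > π, which is the divisor in Im a.
  have hlog : 4 ≤ |Real.log ‖W‖| := by
    by_contra! hc
    rw [abs_lt] at hc
    have h1 : ‖W‖ < Real.exp 4 := by
      rw [← Real.exp_log hWp]; exact Real.exp_lt_exp.2 hc.2
    have h2 : ‖W‖⁻¹ < Real.exp 4 := by
      rw [← Real.exp_log hWp, ← Real.exp_neg]; exact Real.exp_lt_exp.2 (by linarith)
    linarith
  rw [aFun_im, abs_neg, abs_div, abs_of_pos Real.pi_pos, le_div_iff₀ Real.pi_pos]
  linarith [Real.pi_lt_four]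

/-- The bound is a closed condition valid on a full neighbourhood of λ, cut included, so it passes
to either boundary value. -/
theorem one_le_abs_im_of_isValueOfA {lam α : ℂ} (h0 : lam ≠ 0)
    (h : ‖lam‖ < Real.exp (-4) / 2) (hα : IsValueOfA lam α) : 1 ≤ |α.im| := by
  have hev : ∀ᶠ z in 𝓝 lam, 1 ≤ |(aFun z).im| := by
    filter_upwards [isOpen_ne.mem_nhds h0,
      (continuous_norm.isOpen_preimage _ isOpen_Iio).mem_nhds h] with z hz1 hz2
    exact one_le_abs_aFun_im hz1 hz2
  have key : ∀ s : Set ℂ, lam ∈ closure s → Tendsto aFun (𝓝[s] lam) (𝓝 α) →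
      1 ≤ |α.im| := by
    intro s hs ht
    have : (𝓝[s] lam).NeBot := mem_closure_iff_nhdsWithin_neBot.1 hs
    exact ge_of_tendsto ((Complex.continuous_im.abs.tendsto α).comp ht)
      (nhdsWithin_le_nhds hev)
  rcases hα with ⟨hl, ht⟩ | ⟨hl, ht⟩
  · exact key _ (by rw [Complex.closure_setOfPred_lt_im]; exact hl) ht
  · exact key _ (by rw [Complex.closure_setOfPred_im_lt]; exact hl) ht

/-! ### The saddle point -/

/-- `c` is the saddle point of `t (1 - t) / (1 - w t)` near `1/2`, for a small parameter `w`. -/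
structure IsSaddle (w c : ℂ) : Prop where
  eqn : w * c ^ 2 - 2 * c + 1 = 0
  small : ‖w‖ ≤ 1 / 1000
  near : ‖c - 1 / 2‖ ≤ 1 / 2000

/-- For 0 ≤ arg η both roots A = η^(1/2) and B = (η-1)^(1/2) lie in the closed first quadrant, so
Re(B · conj A) ≥ 0. This excludes B = -Ak, where k is the root of 1 - 1/η near 1. -/
theorem tMinus_eq {η : ℂ} (h0 : η ≠ 0) (ha : 0 ≤ η.arg) (hw : ‖η⁻¹‖ ≤ 1 / 1000) :
    ∃ k : ℂ, k ^ 2 = 1 - η⁻¹ ∧ ‖1 - k‖ ≤ ‖η⁻¹‖ ∧ tMinus η = η - η * k := by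
  set k := (1 - η⁻¹) ^ (1 / 2 : ℂ) with hk
  have hk2 : k ^ 2 = 1 - η⁻¹ := cpow_half_sq _
  have hkre : 0 ≤ k.re := cpow_half_re_nonneg _
  have hk1 : ‖1 - k‖ ≤ ‖η⁻¹‖ := by
    have h1 : 1 ≤ ‖1 + k‖ := by
      refine le_trans ?_ (Complex.re_le_norm _)
      simpa using hkre
    have h2 : ‖1 - k‖ * ‖1 + k‖ = ‖η⁻¹‖ := by
      rw [← norm_mul]; congr 1; linear_combination -hk2
    nlinarith [norm_nonneg (1 - k)]
  refine ⟨k, hk2, hk1, ?_⟩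
  have hkpos : 0 < k.re := by
    have := (Complex.re_le_norm (1 - k)).trans (hk1.trans hw)
    simp at this; linarith
  have hA2 : (η ^ (1 / 2 : ℂ)) ^ 2 = η := cpow_half_sq _
  have hB2 : ((η - 1) ^ (1 / 2 : ℂ)) ^ 2 = η - 1 := cpow_half_sq _
  have hAre := cpow_half_re_nonneg η
  have hBre := cpow_half_re_nonneg (η - 1)
  have hAim := cpow_half_im_nonneg ha
  have hBim : 0 ≤ ((η - 1) ^ (1 / 2 : ℂ)).im := by
    apply cpow_half_im_nonneg
    rw [Complex.arg_nonneg_iff] at ha ⊢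
    simpa using ha
  rw [tMinus]
  set A := η ^ (1 / 2 : ℂ)
  set B := (η - 1) ^ (1 / 2 : ℂ)
  have hA0 : A ≠ 0 := by rintro h; apply h0; rw [← hA2, h]; simp
  have hsq : B ^ 2 = (A * k) ^ 2 := by
    rw [mul_pow, hA2, hB2, hk2]; field_simp
  have hB : B = A * k := by
    rcases sq_eq_sq_iff_eq_or_eq_neg.1 hsq with h | h
    · exact h
    · exfalso
      have h1 : (B * (starRingEnd ℂ) A).re = -(Complex.normSq A * k.re) := by
        rw [h]
        have : -(A * k) * (starRingEnd ℂ) A = -((Complex.normSq A : ℂ) * k) := by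
          rw [Complex.normSq_eq_conj_mul_self]; ring
        rw [this]; simp
      have h2 : (B * (starRingEnd ℂ) A).re = B.re * A.re + B.im * A.im := by
        simp [Complex.mul_re]
      have h3 : 0 < Complex.normSq A * k.re := mul_pos (Complex.normSq_pos.2 hA0) hkpos
      nlinarith [mul_nonneg hBre hAre, mul_nonneg hBim hAim]
  rw [hB]
  linear_combination (-k) * hA2

theorem isSaddle_tMinus {M : ℝ} (hM : 1000 ≤ M) {η : ℂ} (hη : η ∈ OmegaPlus M) :
    IsSaddle η⁻¹ (tMinus η) := by
  obtain ⟨h1, -, h3, -⟩ := hη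
  have hpos : 0 < ‖η‖ := by linarith
  have h0 : η ≠ 0 := norm_pos_iff.1 hpos
  have hw : ‖η⁻¹‖ ≤ 1 / 1000 := by
    rw [norm_inv, inv_le_comm₀ hpos (by norm_num)]; norm_num; linarith
  obtain ⟨k, hk2, hk1, ht⟩ := tMinus_eq h0 h3 hw
  have hk3 : η * (1 - k ^ 2) = 1 := by rw [hk2]; field_simp; ring
  -- The form c = 1/(1+k) avoids the cancellation in η - ηk.
  have hc : tMinus η * (1 + k) = 1 := by rw [ht]; linear_combination hk3
  have hre : 1 ≤ ‖1 + k‖ := by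
    have := (Complex.re_le_norm (1 - k)).trans (hk1.trans hw)
    have h5 := Complex.re_le_norm (1 + k)
    simp at this h5; linarith
  have hk0 : 1 + k ≠ 0 := by intro h; simp [h] at hre; linarith
  refine ⟨?_, hw, ?_⟩
  · have : η⁻¹ = 1 - k ^ 2 := by rw [hk2]; ring
    rw [this]
    linear_combination ((1 - k) * tMinus η - 1) * hc
  · have : tMinus η - 1 / 2 = (1 - k) / (2 * (1 + k)) := by
      field_simp; linear_combination 2 * hc
    rw [this, norm_div, norm_mul, div_le_iff₀ (by simp; positivity)]
    simp
    linarith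

/-! ### A local Laplace estimate -/

/-- Second order Taylor estimate for a bounded holomorphic function on a disc. -/
theorem norm_sub_sub_deriv_le {f : ℂ → ℂ} {c : ℂ} {R B : ℝ} (hR : 0 < R)
    (hf : DifferentiableOn ℂ f (Metric.ball c R)) (hB : ∀ z ∈ Metric.ball c R, ‖f z‖ ≤ B) :
    ‖deriv f c‖ ≤ 2 * B / R ∧ ∀ z ∈ Metric.ball c R,
      ‖f z - f c - deriv f c * (z - c)‖ ≤ 4 * B / R ^ 2 * ‖z - c‖ ^ 2 := by
  have hcm : c ∈ Metric.ball c R := Metric.mem_ball_self hR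
  have hnhds : Metric.ball c R ∈ 𝓝 c := Metric.ball_mem_nhds c hR
  have hd1 : DifferentiableOn ℂ (dslope f c) (Metric.ball c R) :=
    (Complex.differentiableOn_dslope hnhds).2 hf
  -- The Schwarz lemma bounds the difference quotient of f; applied again to that quotient, it
  -- bounds the second-order one.
  have h1 : ∀ z ∈ Metric.ball c R, ‖dslope f c z‖ ≤ 2 * B / R := fun z hz =>
    Complex.norm_dslope_le_div_of_mapsTo_ball hf (fun y hy => by
      rw [Metric.mem_closedBall, dist_eq_norm]
      linarith [norm_sub_le (f y) (f c), hB y hy, hB c hcm]) hz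
  have h2 : ∀ z ∈ Metric.ball c R, ‖dslope (dslope f c) c z‖ ≤ 2 * (2 * B / R) / R :=
    fun z hz => Complex.norm_dslope_le_div_of_mapsTo_ball hd1 (fun y hy => by
      rw [Metric.mem_closedBall, dist_eq_norm]
      linarith [norm_sub_le (dslope f c y) (dslope f c c), h1 y hy, h1 c hcm]) hz
  refine ⟨by simpa using h1 c hcm, fun z hz => ?_⟩
  have e1 : (z - c) * dslope f c z = f z - f c := by
    simpa using sub_smul_dslope f c z
  have e2 : (z - c) * dslope (dslope f c) c z = dslope f c z - deriv f c := by
    simpa using sub_smul_dslope (dslope f c) c z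
  have e : f z - f c - deriv f c * (z - c) = dslope (dslope f c) c z * (z - c) ^ 2 := by
    linear_combination -e1 - (z - c) * e2
  rw [e, norm_mul, norm_pow]
  refine mul_le_mul_of_nonneg_right ((h2 z hz).trans_eq ?_) (by positivity)
  field_simp; ring

theorem norm_exp_sub_one_sub_le (z : ℂ) :
    ‖Complex.exp z - 1 - z‖ ≤ ‖z‖ ^ 2 * Real.exp ‖z‖ := by
  have h := Complex.norm_exp_sub_sum_le_norm_mul_exp z 2
  simpa [Finset.sum_range_succ, sub_sub] using h

theorem norm_cexp_neg_mul_sq_le {κ x : ℝ} {q : ℂ} (hκ : 0 ≤ κ) (hq : 6 ≤ q.re) :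
    ‖Complex.exp (-(κ * q) * x ^ 2)‖ ≤ Real.exp (-(6 * (κ * x ^ 2))) := by
  rw [Complex.norm_exp]
  apply Real.exp_le_exp.2
  have : (-(κ * q) * (x : ℂ) ^ 2) = ((-(κ * x ^ 2) : ℝ) : ℂ) * q := by push_cast; ring
  rw [this, Complex.re_ofReal_mul]
  nlinarith [mul_nonneg hκ (sq_nonneg x)]

/-- Pointwise comparison of a perturbed Gaussian with its expansion to first order. -/
theorem norm_integrand_sub_model_le {b₀ b₁ B P₃ P₄ κ x : ℝ} {h φ f₀ f₁ q p : ℂ} (hκ : 0 < κ)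
    (hf₀ : ‖f₀‖ ≤ b₀) (hf₁ : ‖f₁ * x‖ ≤ b₁) (hp : ‖f₁ * p‖ ≤ B) (hP₄ : 0 ≤ P₄)
    (hq : 6 ≤ q.re) (hh : ‖h - f₀ - f₁ * x‖ ≤ B * x ^ 2) (hφ₂ : ‖φ + q * x ^ 2‖ ≤ x ^ 2)
    (hφ₃ : ‖φ + q * x ^ 2‖ ≤ P₃ * |x| ^ 3) (hφ₄ : ‖φ + q * x ^ 2 - p * x ^ 3‖ ≤ P₄ * x ^ 4) :
    ‖h * Complex.exp (κ * φ) - Complex.exp (-(κ * q) * x ^ 2) * (f₀ + f₁ * x + f₀ * κ * p * x ^ 3)‖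
      ≤ (2 * B + (b₀ + b₁) * (P₃ ^ 2 + P₄)) / κ * Real.exp (-κ * x ^ 2) := by
  set y : ℝ := κ * x ^ 2 with hy
  have hy0 : 0 ≤ y := by positivity
  have hb₀ : 0 ≤ b₀ := (norm_nonneg _).trans hf₀
  have hb₁ : 0 ≤ b₁ := (norm_nonneg _).trans hf₁
  have hB : 0 ≤ B := (norm_nonneg _).trans hp
  set z : ℂ := κ * (φ + q * x ^ 2) with hz
  set e : ℂ := Complex.exp (-(κ * q) * x ^ 2) with he
  have hzy : ‖z‖ ≤ y := by
    rw [hz, norm_mul, Complex.norm_real, Real.norm_of_nonneg hκ.le]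
    exact mul_le_mul_of_nonneg_left hφ₂ hκ.le
  have hz2 : κ * ‖z‖ ^ 2 ≤ P₃ ^ 2 * y ^ 3 := by
    rw [hz, norm_mul, Complex.norm_real, Real.norm_of_nonneg hκ.le]
    calc κ * (κ * ‖φ + q * x ^ 2‖) ^ 2 ≤ κ * (κ * (P₃ * |x| ^ 3)) ^ 2 := by gcongr
      _ = P₃ ^ 2 * (κ * |x| ^ 2) ^ 3 := by ring
      _ = P₃ ^ 2 * y ^ 3 := by rw [sq_abs]
  have hz3 : κ * ‖z - κ * p * x ^ 3‖ ≤ P₄ * y ^ 2 := by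
    have : z - κ * p * x ^ 3 = κ * (φ + q * x ^ 2 - p * x ^ 3) := by rw [hz]; ring
    rw [this, norm_mul, Complex.norm_real, Real.norm_of_nonneg hκ.le]
    calc κ * (κ * ‖φ + q * x ^ 2 - p * x ^ 3‖) ≤ κ * (κ * (P₄ * x ^ 4)) := by gcongr
      _ = P₄ * y ^ 2 := by rw [hy]; ring
  have hexp : ‖Complex.exp z‖ ≤ Real.exp y :=
    (Complex.norm_exp_le_exp_norm z).trans (Real.exp_le_exp.2 hzy)
  have hez : ‖Complex.exp z - 1 - z‖ ≤ ‖z‖ ^ 2 * Real.exp y :=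
    (norm_exp_sub_one_sub_le z).trans (by gcongr)
  have hsum : ‖f₀ + f₁ * x‖ ≤ b₀ + b₁ := norm_add_le_of_le hf₀ hf₁
  -- The product of the linear term of h and the cubic term of φ is even in x, so it cannot be
  -- discarded by parity. It is the last summand here and is counted as an error.
  have hsplit : h * Complex.exp (κ * φ) - e * (f₀ + f₁ * x + f₀ * κ * p * x ^ 3) =
      e * ((h - f₀ - f₁ * x) * Complex.exp z + (f₀ + f₁ * x) * (Complex.exp z - 1 - z) +
        (f₀ + f₁ * x) * (z - κ * p * x ^ 3) + f₁ * p * (κ * x ^ 4 : ℝ)) := by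
    have : Complex.exp (κ * φ) = e * Complex.exp z := by
      rw [he, hz, ← Complex.exp_add]; congr 1; ring
    rw [this]; push_cast; ring
  -- Each remainder is 1/κ times a power of y = κx², possibly with a factor exp y. All are absorbed
  -- in exp(5y), and Re q ≥ 6 leaves exp(-y).
  have hpow : ∀ n : ℕ, n ≤ 4 → y ^ n ≤ Real.exp (4 * y) := fun n hn => by
    calc y ^ n ≤ Real.exp y ^ n := by
          gcongr; linarith [Real.add_one_le_exp y]
      _ = Real.exp (n * y) := (Real.exp_nat_mul y n).symm
      _ ≤ _ := by gcongr; exact_mod_cast hn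
  have hpow5 : ∀ n : ℕ, n ≤ 4 → y ^ n * Real.exp y ≤ Real.exp (5 * y) := fun n hn => by
    calc y ^ n * Real.exp y ≤ Real.exp (4 * y) * Real.exp y := by gcongr; exact hpow n hn
      _ = _ := by rw [← Real.exp_add]; ring_nf
  have hpow5' : ∀ n : ℕ, n ≤ 4 → y ^ n ≤ Real.exp (5 * y) := fun n hn =>
    (hpow n hn).trans (Real.exp_le_exp.2 (by linarith))
  have hP₄y : P₄ * y ^ 2 ≤ P₄ * Real.exp (5 * y) := by
    gcongr; exact hpow5' 2 (by norm_num)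
  rw [hsplit, norm_mul]
  have hmain : ‖(h - f₀ - f₁ * x) * Complex.exp z + (f₀ + f₁ * x) * (Complex.exp z - 1 - z) +
        (f₀ + f₁ * x) * (z - κ * p * x ^ 3) + f₁ * p * (κ * x ^ 4 : ℝ)‖ ≤
      (2 * B + (b₀ + b₁) * (P₃ ^ 2 + P₄)) / κ * Real.exp (5 * y) := by
    rw [div_mul_eq_mul_div, le_div_iff₀' hκ]
    have t1 : κ * ‖(h - f₀ - f₁ * x) * Complex.exp z‖ ≤ B * Real.exp (5 * y) := by
      rw [norm_mul]
      calc κ * (‖h - f₀ - f₁ * x‖ * ‖Complex.exp z‖) ≤ κ * (B * x ^ 2 * Real.exp y) := by gcongr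
        _ = B * (y ^ 1 * Real.exp y) := by rw [hy]; ring
        _ ≤ _ := by gcongr; exact hpow5 1 (by norm_num)
    have t2 : κ * ‖(f₀ + f₁ * x) * (Complex.exp z - 1 - z)‖ ≤
        (b₀ + b₁) * (P₃ ^ 2 * Real.exp (5 * y)) := by
      rw [norm_mul]
      calc κ * (‖f₀ + f₁ * x‖ * ‖Complex.exp z - 1 - z‖)
          ≤ κ * ((b₀ + b₁) * (‖z‖ ^ 2 * Real.exp y)) := by gcongr
        _ = (b₀ + b₁) * (κ * ‖z‖ ^ 2 * Real.exp y) := by ring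
        _ ≤ (b₀ + b₁) * (P₃ ^ 2 * y ^ 3 * Real.exp y) := by gcongr
        _ = (b₀ + b₁) * (P₃ ^ 2 * (y ^ 3 * Real.exp y)) := by ring
        _ ≤ _ := by gcongr; exact hpow5 3 (by norm_num)
    have t3 : κ * ‖(f₀ + f₁ * x) * (z - κ * p * x ^ 3)‖ ≤ (b₀ + b₁) * (P₄ * Real.exp (5 * y)) := by
      rw [norm_mul]
      calc κ * (‖f₀ + f₁ * x‖ * ‖z - κ * p * x ^ 3‖)
          = ‖f₀ + f₁ * x‖ * (κ * ‖z - κ * p * x ^ 3‖) := by ring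
        _ ≤ (b₀ + b₁) * (P₄ * Real.exp (5 * y)) :=
            mul_le_mul hsum (hz3.trans hP₄y) (by positivity) (by positivity)
    have t4 : κ * ‖f₁ * p * (κ * x ^ 4 : ℝ)‖ ≤ B * Real.exp (5 * y) := by
      rw [norm_mul, Complex.norm_real, Real.norm_of_nonneg (by positivity)]
      calc κ * (‖f₁ * p‖ * (κ * x ^ 4)) ≤ κ * (B * (κ * x ^ 4)) := by gcongr
        _ = B * y ^ 2 := by rw [hy]; ring
        _ ≤ _ := by gcongr; exact hpow5' 2 (by norm_num)
    have tri := norm_add₄_le (a := (h - f₀ - f₁ * x) * Complex.exp z)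
      (b := (f₀ + f₁ * x) * (Complex.exp z - 1 - z)) (c := (f₀ + f₁ * x) * (z - κ * p * x ^ 3))
      (d := f₁ * p * (κ * x ^ 4 : ℝ))
    have := mul_le_mul_of_nonneg_left tri hκ.le
    linarith
  have hge : ‖e‖ ≤ Real.exp (-(6 * y)) := norm_cexp_neg_mul_sq_le hκ.le hq
  calc _ ≤ Real.exp (-(6 * y)) *
        ((2 * B + (b₀ + b₁) * (P₃ ^ 2 + P₄)) / κ * Real.exp (5 * y)) := by gcongr
    _ = (2 * B + (b₀ + b₁) * (P₃ ^ 2 + P₄)) / κ * (Real.exp (-(6 * y)) * Real.exp (5 * y)) := by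
        ring
    _ = _ := by rw [← Real.exp_add, hy]; ring_nf

/-- The odd part N of the model vanishes on the symmetric interval. The rest is compared with the
Gaussian on the whole line, so that the tails and the local error are dominated by one multiple of
exp(-κx²). -/
theorem norm_integral_sub_gaussian_le {r b₀ b₁ B P₃ P₄ κ : ℝ} {h φ : ℝ → ℂ} {f₀ f₁ q p : ℂ}
    (hr : 0 < r) (hκ : 0 < κ)
    (hf₀ : ‖f₀‖ ≤ b₀) (hf₁ : ‖f₁‖ * r ≤ b₁) (hp : ‖f₁ * p‖ ≤ B) (hq : 6 ≤ q.re)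
    (hhc : ContinuousOn h (Set.Icc (-r) r)) (hφc : ContinuousOn φ (Set.Icc (-r) r))
    (hh : ∀ x ∈ Set.Icc (-r) r, ‖h x - f₀ - f₁ * x‖ ≤ B * x ^ 2)
    (hφ₂ : ∀ x ∈ Set.Icc (-r) r, ‖φ x + q * x ^ 2‖ ≤ x ^ 2)
    (hφ₃ : ∀ x ∈ Set.Icc (-r) r, ‖φ x + q * x ^ 2‖ ≤ P₃ * |x| ^ 3)
    (hφ₄ : ∀ x ∈ Set.Icc (-r) r, ‖φ x + q * x ^ 2 - p * x ^ 3‖ ≤ P₄ * x ^ 4) :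
    ‖(∫ x in (-r)..r, h x * Complex.exp (κ * φ x)) - f₀ * (Real.pi / (κ * q)) ^ (1 / 2 : ℂ)‖
      ≤ (2 * B + (b₀ + b₁) * (P₃ ^ 2 + P₄) + b₀ / r ^ 2) / κ * √(Real.pi / κ) := by
  set D : ℝ := 2 * B + (b₀ + b₁) * (P₃ ^ 2 + P₄) with hD
  set N : ℝ → ℂ := fun x => Complex.exp (-(κ * q) * x ^ 2) * (f₁ * x + f₀ * κ * p * x ^ 3) with hN
  set G : ℝ → ℂ := fun x => h x * Complex.exp (κ * φ x) with hG
  set g : ℝ → ℂ := fun x => Complex.exp (-(κ * q) * x ^ 2) with hg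
  have hrr : -r ≤ r := by linarith
  have hκq : 0 < (κ * q : ℂ).re := by rw [Complex.re_ofReal_mul]; nlinarith
  have hNc : Continuous N := by fun_prop
  have hgi : MeasureTheory.Integrable g := integrable_cexp_neg_mul_sq hκq
  have hgint : ∫ x, g x = (Real.pi / (κ * q)) ^ (1 / 2 : ℂ) := integral_gaussian_complex hκq
  have hN0 : ∫ x in (-r)..r, N x = 0 := by
    have h1 : ∫ x in (-r)..r, N (-x) = ∫ x in (-r)..r, N x := by
      simp
    have h2 : ∀ x : ℝ, N (-x) = -N x := by
      intro x; simp only [hN]; push_cast; ring_nf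
    simp only [h2, intervalIntegral.integral_neg] at h1
    exact self_eq_neg.1 h1.symm
  have hGc : ContinuousOn G (Set.Icc (-r) r) := by fun_prop
  have hGi : IntervalIntegrable G MeasureTheory.volume (-r) r :=
    ContinuousOn.intervalIntegrable (by rwa [Set.uIcc_of_le hrr])
  have hNi : IntervalIntegrable N MeasureTheory.volume (-r) r := hNc.intervalIntegrable _ _
  have hind : MeasureTheory.Integrable ((Set.Ioc (-r) r).indicator fun x => G x - N x) :=
    ((hGi.sub hNi).1).integrable_indicator measurableSet_Ioc
  have hdiff : (∫ x in (-r)..r, G x) - f₀ * (Real.pi / (κ * q)) ^ (1 / 2 : ℂ) =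
      ∫ x, ((Set.Ioc (-r) r).indicator (fun x => G x - N x) x - f₀ * g x) := by
    rw [MeasureTheory.integral_sub hind (hgi.const_mul _), MeasureTheory.integral_const_mul, hgint,
      MeasureTheory.integral_indicator measurableSet_Ioc,
      ← intervalIntegral.integral_of_le hrr, intervalIntegral.integral_sub hGi hNi, hN0, sub_zero]
  have hb₀ : 0 ≤ b₀ := (norm_nonneg _).trans hf₀
  have hb₁ : 0 ≤ b₁ := le_trans (by positivity) hf₁
  have hB : 0 ≤ B := (norm_nonneg _).trans hp
  have hP₄ : 0 ≤ P₄ := by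
    have := (norm_nonneg _).trans (hφ₄ r ⟨hrr, le_rfl⟩)
    exact nonneg_of_mul_nonneg_left this (by positivity)
  have hDn : 0 ≤ D := by positivity
  have hpt : ∀ x : ℝ, ‖(Set.Ioc (-r) r).indicator (fun x => G x - N x) x - f₀ * g x‖ ≤
      (D + b₀ / r ^ 2) / κ * Real.exp (-κ * x ^ 2) := by
    intro x
    by_cases hx : x ∈ Set.Ioc (-r) r
    · have hx' := Set.Ioc_subset_Icc_self hx
      rw [Set.indicator_of_mem hx]
      have hxr : ‖(f₁ * x : ℂ)‖ ≤ b₁ := by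
        rw [norm_mul, Complex.norm_real, Real.norm_eq_abs]
        exact (mul_le_mul_of_nonneg_left (abs_le.2 hx') (norm_nonneg _)).trans hf₁
      have := norm_integrand_sub_model_le hκ hf₀ hxr hp hP₄ hq (hh x hx') (hφ₂ x hx') (hφ₃ x hx')
        (hφ₄ x hx')
      have e : G x - N x - f₀ * g x = h x * Complex.exp (κ * φ x) -
          Complex.exp (-(κ * q) * x ^ 2) * (f₀ + f₁ * x + f₀ * κ * p * x ^ 3) := by
        simp only [hG, hN, hg]; ring
      rw [e]
      refine this.trans (mul_le_mul_of_nonneg_right ?_ (Real.exp_pos _).le)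
      exact div_le_div_of_nonneg_right (le_add_of_nonneg_right (by positivity)) hκ.le
    · rw [Set.indicator_of_notMem hx, zero_sub, norm_neg, norm_mul]
      have hx2 : r ^ 2 ≤ x ^ 2 := by
        rw [sq_le_sq, abs_of_pos hr]
        by_contra! hc
        exact hx ⟨(abs_lt.1 hc).1, (abs_lt.1 hc).2.le⟩
      -- Outside the interval κx² ≥ κr², so the tail gains the factor 1/(κr²) by giving up part of
      -- its exponential decay.
      have h1 : Real.exp (-(6 * (κ * x ^ 2))) ≤ 1 / r ^ 2 / κ * Real.exp (-κ * x ^ 2) := by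
        have h2 : κ * x ^ 2 * Real.exp (-(6 * (κ * x ^ 2))) ≤ Real.exp (-κ * x ^ 2) := by
          have h3 : κ * x ^ 2 ≤ Real.exp (κ * x ^ 2) := by
            linarith [Real.add_one_le_exp (κ * x ^ 2)]
          calc _ ≤ Real.exp (κ * x ^ 2) * Real.exp (-(6 * (κ * x ^ 2))) := by gcongr
            _ = Real.exp (-(5 * (κ * x ^ 2))) := by rw [← Real.exp_add]; ring_nf
            _ ≤ _ := Real.exp_le_exp.2 (by nlinarith [mul_nonneg hκ.le (sq_nonneg x)])
        rw [div_div, div_mul_eq_mul_div, one_mul, le_div_iff₀ (by positivity)]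
        refine le_trans ?_ h2
        rw [mul_comm]
        refine mul_le_mul_of_nonneg_right ?_ (Real.exp_pos _).le
        nlinarith
      calc ‖f₀‖ * ‖g x‖ ≤ b₀ * (1 / r ^ 2 / κ * Real.exp (-κ * x ^ 2)) := by
            gcongr
            exact (norm_cexp_neg_mul_sq_le hκ.le hq).trans h1
        _ = (b₀ / r ^ 2) / κ * Real.exp (-κ * x ^ 2) := by ring
        _ ≤ _ := by gcongr; linarith
  rw [hdiff]
  calc _ ≤ ∫ x : ℝ, (D + b₀ / r ^ 2) / κ * Real.exp (-κ * x ^ 2) :=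
        MeasureTheory.norm_integral_le_of_norm_le
          ((integrable_exp_neg_mul_sq hκ).const_mul _) (Eventually.of_forall hpt)
    _ = _ := by rw [MeasureTheory.integral_const_mul, integral_gaussian]

/-! ### The phase function -/

/-- The logarithm of `t (1 - t) / (1 - w t)`, cut as in the phase `S`. -/
noncomputable def phase (w t : ℂ) : ℂ :=
  Complex.log t + Complex.log (1 - t) - Complex.log (1 - w * t)

theorem S_eq_phase (η t : ℂ) : S η t = -Complex.I * phase η⁻¹ t := by
  rw [S, phase, div_eq_inv_mul]

theorem log_add_log_of_re_pos {a b : ℂ} (ha : 0 < a.re) (hb : 0 < b.re) :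
    Complex.log a + Complex.log b = Complex.log (a * b) := by
  have ha0 : a ≠ 0 := by rintro rfl; simp at ha
  have hb0 : b ≠ 0 := by rintro rfl; simp at hb
  have h1 := abs_lt.1 (Complex.abs_arg_lt_pi_div_two_iff.2 (Or.inl ha))
  have h2 := abs_lt.1 (Complex.abs_arg_lt_pi_div_two_iff.2 (Or.inl hb))
  exact ((Complex.log_mul_eq_add_log_iff ha0 hb0).2
    ⟨by linarith [h1.1, h2.1], by linarith [h1.2, h2.2]⟩).symm

theorem re_pos_of_norm_one_sub_lt {z : ℂ} (h : ‖1 - z‖ < 1) : 0 < z.re := by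
  have := (Complex.re_le_norm (1 - z)).trans_lt h
  simp at this
  exact this

theorem mem_disc_iff {t : ℂ} : t ∈ disc ↔ ‖t - 1 / 2‖ < 1 / 2 := by
  rw [disc, Metric.mem_ball, dist_eq_norm]

theorem re_pos_of_mem_disc {t : ℂ} (ht : t ∈ disc) : 0 < t.re := by
  have := (Complex.abs_re_le_norm (t - 1 / 2)).trans_lt (mem_disc_iff.1 ht)
  rw [abs_lt] at this
  simp at this
  linarith [this.1]

theorem one_sub_mem_disc {t : ℂ} (ht : t ∈ disc) : 1 - t ∈ disc := by
  rw [mem_disc_iff] at ht ⊢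
  rwa [show 1 - t - 1 / 2 = -(t - 1 / 2) by ring, norm_neg]

theorem norm_lt_one_of_mem_disc {t : ℂ} (ht : t ∈ disc) : ‖t‖ < 1 := by
  have h := mem_disc_iff.1 ht
  calc ‖t‖ = ‖(t - 1 / 2) + 1 / 2‖ := by ring_nf
    _ ≤ ‖t - 1 / 2‖ + ‖(1 / 2 : ℂ)‖ := norm_add_le _ _
    _ < 1 := by norm_num; linarith

theorem norm_mul_le_of_mem_disc {w t : ℂ} (hw : ‖w‖ ≤ 1 / 1000) (ht : t ∈ disc) :
    ‖w * t‖ ≤ 1 / 1000 := by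
  rw [norm_mul]
  nlinarith [norm_lt_one_of_mem_disc ht, norm_nonneg w, norm_nonneg t]

theorem re_one_sub_mul_pos {w t : ℂ} (hw : ‖w‖ ≤ 1 / 1000) (ht : t ∈ disc) :
    0 < (1 - w * t).re := by
  apply re_pos_of_norm_one_sub_lt
  rw [sub_sub_cancel]
  linarith [norm_mul_le_of_mem_disc hw ht]

theorem hasDerivAt_phase {w t : ℂ} (hw : ‖w‖ ≤ 1 / 1000) (ht : t ∈ disc) :
    HasDerivAt (phase w) (t⁻¹ - (1 - t)⁻¹ + w * (1 - w * t)⁻¹) t := by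
  have h1 : HasDerivAt (fun t : ℂ => Complex.log t) (1 / t) t :=
    (hasDerivAt_id t).clog (Or.inl (re_pos_of_mem_disc ht))
  have h2 : HasDerivAt (fun t : ℂ => Complex.log (1 - t)) (-1 / (1 - t)) t :=
    ((hasDerivAt_id t).const_sub 1).clog (Or.inl (re_pos_of_mem_disc (one_sub_mem_disc ht)))
  have h3 : HasDerivAt (fun t : ℂ => Complex.log (1 - w * t)) (-(w * 1) / (1 - w * t)) t :=
    (((hasDerivAt_id t).const_mul w).const_sub 1).clog (Or.inl (re_one_sub_mul_pos hw ht))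
  exact ((h1.add h2).sub h3).congr_deriv (by ring)

theorem differentiableOn_phase {w : ℂ} (hw : ‖w‖ ≤ 1 / 1000) :
    DifferentiableOn ℂ (phase w) disc := fun _ ht =>
  (hasDerivAt_phase hw ht).differentiableAt.differentiableWithinAt

namespace IsSaddle

variable {w c : ℂ}

theorem mem_disc (h : IsSaddle w c) : c ∈ disc := by
  rw [mem_disc_iff]; linarith [h.near]

theorem norm_mul_one_sub_sub_le (h : IsSaddle w c) : ‖c * (1 - c) - 1 / 4‖ ≤ 1 / 1000000 := by
  rw [show c * (1 - c) - 1 / 4 = -((c - 1 / 2) ^ 2) by ring, norm_neg, norm_pow]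
  nlinarith [h.near, norm_nonneg (c - 1 / 2)]

theorem le_norm_mul_one_sub (h : IsSaddle w c) : 24 / 100 ≤ ‖c * (1 - c)‖ := by
  have h1 := norm_sub_norm_le (1 / 4 : ℂ) (c * (1 - c))
  rw [norm_sub_rev] at h1
  have h2 : ‖(1 / 4 : ℂ)‖ = 1 / 4 := by norm_num
  linarith [h.norm_mul_one_sub_sub_le]

theorem mul_one_sub_ne_zero (h : IsSaddle w c) : c * (1 - c) ≠ 0 :=
  norm_pos_iff.1 (by linarith [h.le_norm_mul_one_sub])

theorem ne_zero (h : IsSaddle w c) : c ≠ 0 := left_ne_zero_of_mul h.mul_one_sub_ne_zero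

theorem one_sub_ne_zero (h : IsSaddle w c) : 1 - c ≠ 0 := right_ne_zero_of_mul h.mul_one_sub_ne_zero

theorem norm_le (h : IsSaddle w c) : ‖c‖ ≤ 501 / 1000 := by
  calc ‖c‖ = ‖(c - 1 / 2) + 1 / 2‖ := by ring_nf
    _ ≤ ‖c - 1 / 2‖ + ‖(1 / 2 : ℂ)‖ := norm_add_le _ _
    _ ≤ 501 / 1000 := by norm_num; linarith [h.near]

theorem le_norm (h : IsSaddle w c) : 499 / 1000 ≤ ‖c‖ := by
  have h1 := norm_sub_norm_le (1 / 2 : ℂ) c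
  rw [norm_sub_rev] at h1
  have h2 : ‖(1 / 2 : ℂ)‖ = 1 / 2 := by norm_num
  linarith [h.near]

theorem sq_re_pos (h : IsSaddle w c) : 0 < (c ^ 2).re := by
  have h1 := abs_le.1 ((Complex.abs_re_le_norm (c - 1 / 2)).trans h.near)
  have h2 := abs_le.1 ((Complex.abs_im_le_norm (c - 1 / 2)).trans h.near)
  simp at h1 h2
  rw [sq, Complex.mul_re]
  nlinarith [h1.1, h2.1, h2.2]

theorem deriv_two_S {η : ℂ} (h : IsSaddle η⁻¹ c) :
    iteratedDeriv 2 (S η) c = 2 * Complex.I / (c * (1 - c)) := by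
  set w := η⁻¹ with hw
  have hS : S η = fun t => -Complex.I * phase w t := funext fun t => S_eq_phase η t
  have hd : deriv (S η) =ᶠ[𝓝 c]
      fun t => -Complex.I * (t⁻¹ - (1 - t)⁻¹ + w * (1 - w * t)⁻¹) := by
    filter_upwards [Metric.isOpen_ball.mem_nhds h.mem_disc] with t ht
    rw [hS]
    exact ((hasDerivAt_phase h.small ht).const_mul _).deriv
  have hc0 := h.ne_zero
  have hc1 := h.one_sub_ne_zero
  have hw0 : 1 - w * c ≠ 0 := fun h0 => by
    have := re_one_sub_mul_pos h.small h.mem_disc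
    simp [h0] at this
  rw [iteratedDeriv_succ, iteratedDeriv_one, hd.deriv_eq]
  have e1 : HasDerivAt (fun t : ℂ => t⁻¹) (-1 / c ^ 2) c := (hasDerivAt_id c).inv hc0
  have e2 : HasDerivAt (fun t : ℂ => (1 - t)⁻¹) (-(-1) / (1 - c) ^ 2) c :=
    ((hasDerivAt_id c).const_sub 1).inv hc1
  have e3 : HasDerivAt (fun t : ℂ => (1 - w * t)⁻¹) (-(-(w * 1)) / (1 - w * c) ^ 2) c :=
    (((hasDerivAt_id c).const_mul w).const_sub 1).inv hw0
  refine ((((e1.sub e2).add (e3.const_mul w))).const_mul (-Complex.I)).deriv.trans ?_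
  -- The saddle equation eliminates w, which makes the second derivative a function of c alone.
  have hwc : 1 - w * c = (1 - c) / c := by
    field_simp; linear_combination -h.eqn
  have hwe : w = (2 * c - 1) / c ^ 2 := by
    field_simp; linear_combination h.eqn
  rw [hwc, hwe]
  field_simp
  ring

/-- The exact form of the phase around the saddle point. -/
theorem phase_eq (h : IsSaddle w c) {t : ℂ} (ht : ‖t - c‖ ≤ 3 / 20) :
    phase w t = Complex.log (1 - (t - c) ^ 2 / (c ^ 2 * (1 - w * t))) + 2 * Complex.log c := by
  have htd : t ∈ disc := by
    rw [mem_disc_iff]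
    calc ‖t - 1 / 2‖ = ‖(t - c) + (c - 1 / 2)‖ := by ring_nf
      _ ≤ ‖t - c‖ + ‖c - 1 / 2‖ := norm_add_le _ _
      _ < 1 / 2 := by linarith [h.near]
  have hc0 := h.ne_zero
  have hwt := norm_mul_le_of_mem_disc h.small htd
  have hwre := re_one_sub_mul_pos h.small htd
  have hw0 : 1 - w * t ≠ 0 := fun h0 => by simp [h0] at hwre
  have hτ : ‖(t - c) ^ 2 / c ^ 2‖ ≤ 1 / 10 := by
    rw [norm_div, norm_pow, norm_pow, div_le_iff₀ (by have := h.le_norm; positivity)]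
    nlinarith [h.le_norm, norm_nonneg (t - c)]
  have hwn : 999 / 1000 ≤ ‖1 - w * t‖ := by
    have h1 := norm_sub_norm_le (1 : ℂ) (w * t)
    rw [norm_one] at h1
    linarith
  set u := (t - c) ^ 2 / (c ^ 2 * (1 - w * t)) with hu
  have hu1 : u = (t - c) ^ 2 / c ^ 2 / (1 - w * t) := by rw [hu]; field_simp
  have hun : ‖u‖ < 1 := by
    rw [hu1, norm_div, div_lt_iff₀ (by linarith)]; linarith
  have hure : 0 < (1 - u).re := re_pos_of_norm_one_sub_lt (by rwa [sub_sub_cancel])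
  have hprod : (1 - u) * (1 - w * t) = 1 - (w * t + (t - c) ^ 2 / c ^ 2) := by
    have hmul : u * (1 - w * t) = (t - c) ^ 2 / c ^ 2 := by rw [hu1, div_mul_cancel₀ _ hw0]
    linear_combination -hmul
  have hpre : 0 < ((1 - u) * (1 - w * t)).re := by
    apply re_pos_of_norm_one_sub_lt
    rw [hprod, sub_sub_cancel]
    linarith [norm_add_le (w * t) ((t - c) ^ 2 / c ^ 2)]
  have hcre := re_pos_of_mem_disc h.mem_disc
  -- This is the saddle equation in factored form. All factors, and the partial products needed,
  -- have positive real part, so principal logarithms add.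
  have key : t * (1 - t) = (1 - u) * (1 - w * t) * c ^ 2 := by
    rw [hprod]; field_simp; linear_combination t * h.eqn
  have e1 := log_add_log_of_re_pos (re_pos_of_mem_disc htd)
    (re_pos_of_mem_disc (one_sub_mem_disc htd))
  have e2 := log_add_log_of_re_pos hcre hcre
  have e3 := log_add_log_of_re_pos hure hwre
  have e4 := log_add_log_of_re_pos hpre h.sq_re_pos
  rw [← key, ← e1, ← e3, sq c, ← e2] at e4
  rw [phase, ← e4]
  ring

theorem phase_self (h : IsSaddle w c) : phase w c = 2 * Complex.log c := by
  rw [h.phase_eq (by simp; norm_num)]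
  simp

/-- Scaling by 2 does not change the argument, and 2c is within 1/1000 of 1. -/
theorem abs_im_phase_self_le (h : IsSaddle w c) : |(phase w c).im| ≤ 3 / 1000 := by
  have e : (Complex.log (2 * c)).im = (Complex.log c).im := by
    have := Complex.arg_real_mul c (r := 2) (by norm_num)
    simpa [Complex.log_im] using this
  have hn : ‖2 * c - 1‖ ≤ 1 / 1000 := by
    rw [show 2 * c - 1 = 2 * (c - 1 / 2) by ring, norm_mul]
    norm_num; linarith [h.near]
  have h1 := Complex.norm_log_one_add_half_le_self (z := 2 * c - 1) (by linarith)
  rw [add_sub_cancel] at h1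
  have h2 := (Complex.abs_im_le_norm (Complex.log (2 * c))).trans h1
  rw [e] at h2
  rw [h.phase_self]
  simp only [Complex.mul_im, Complex.re_ofNat, Complex.im_ofNat, zero_mul, add_zero, abs_mul]
  norm_num
  linarith

end IsSaddle

/-! ### The phase on the legs of the contour next to the end points -/

/-- For θ = |arg Z|, θ ≥ sin θ = |Im Z|/|Z| ≥ |Im Z|. -/
theorem le_mul_arg {σ b : ℝ} (hσ : σ = 1 ∨ σ = -1) {Z : ℂ} (hb : 0 < b) (h1 : ‖Z‖ ≤ 1)
    (hZ : b ≤ σ * Z.im) : b ≤ σ * Z.arg := by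
  have h0 : Z ≠ 0 := by rintro rfl; simp at hZ; linarith
  have hpos : 0 < ‖Z‖ := norm_pos_iff.2 h0
  have hsin : b ≤ σ * Real.sin Z.arg := by
    rw [Complex.sin_arg, mul_div_assoc', le_div_iff₀ hpos]
    nlinarith
  rcases hσ with rfl | rfl
  · have : 0 ≤ Z.arg := Complex.arg_nonneg_iff.2 (by linarith)
    linarith [Real.sin_le this]
  · have := Complex.arg_neg_iff.2 (show Z.im < 0 by linarith)
    have h2 := Real.sin_le (x := -Z.arg) (by linarith)
    rw [Real.sin_neg] at h2
    linarith

/-- The point at which the contour leaves the leg starting at the end point `0`. -/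
def IsTurningPoint (σ : ℝ) (p : ℂ) : Prop :=
  ‖p - (1 / 2 - (1 - σ * Complex.I) / 10)‖ ≤ 1 / 2000

theorem IsSaddle.isTurningPoint {w c : ℂ} (h : IsSaddle w c) (σ : ℝ) :
    IsTurningPoint σ (c - (1 - σ * Complex.I) / 10) := by
  exact (congrArg norm (by ring)).trans_le h.near

/-- The reflection t ↦ 1 - t sends the second turning point close to the first, with the same σ. One
estimate then serves both outer legs. -/
theorem IsSaddle.isTurningPoint_one_sub {w c : ℂ} (h : IsSaddle w c) (σ : ℝ) :
    IsTurningPoint σ (1 - (c + (1 - σ * Complex.I) / 10)) := by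
  rw [IsTurningPoint, ← norm_neg]
  exact (congrArg norm (by ring)).trans_le h.near

theorem IsTurningPoint.bounds {σ : ℝ} {p : ℂ} (hp : IsTurningPoint σ p) :
    |p.re - 4 / 10| ≤ 1 / 2000 ∧ |p.im - σ / 10| ≤ 1 / 2000 := by
  have hre := (Complex.abs_re_le_norm _).trans hp
  have him := (Complex.abs_im_le_norm _).trans hp
  have e1 : (p - (1 / 2 - (1 - σ * Complex.I) / 10)).re = p.re - 4 / 10 := by
    simp; norm_num
  have e2 : (p - (1 / 2 - (1 - σ * Complex.I) / 10)).im = p.im - σ / 10 := by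
    simp; ring
  rw [e1] at hre
  rw [e2] at him
  exact ⟨hre, him⟩

theorem IsTurningPoint.norm_sub_half_le {σ : ℝ} (hσ : σ = 1 ∨ σ = -1) {p : ℂ}
    (hp : IsTurningPoint σ p) : ‖p - 1 / 2‖ ≤ 1 / 4 := by
  obtain ⟨h1, h2⟩ := hp.bounds
  rw [abs_le] at h1 h2
  have e1 : (p - 1 / 2).re = p.re - 1 / 2 := by simp
  have e2 : (p - 1 / 2).im = p.im := by simp
  refine (Complex.norm_le_abs_re_add_abs_im _).trans ?_
  rw [e1, e2]
  have h3 : |p.re - 1 / 2| ≤ 11 / 100 := abs_le.2 ⟨by linarith, by linarith⟩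
  have h4 : |p.im| ≤ 11 / 100 := by
    rcases hσ with rfl | rfl <;> exact abs_le.2 ⟨by linarith, by linarith⟩
  linarith

theorem mul_mem_disc {s : ℝ} (hs : s ∈ Set.Ioc 0 1) {p : ℂ} (hp : p ∈ disc) :
    (s : ℂ) * p ∈ disc := by
  rw [mem_disc_iff] at hp ⊢
  calc ‖(s : ℂ) * p - 1 / 2‖ = ‖(s : ℂ) * (p - 1 / 2) + ((s - 1) / 2 : ℝ)‖ := by
        congr 1; push_cast; ring
    _ ≤ s * ‖p - 1 / 2‖ + (1 - s) / 2 := by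
        refine norm_add_le_of_le ?_ ?_
        · rw [norm_mul, Complex.norm_real, Real.norm_of_nonneg hs.1.le]
        · rw [Complex.norm_real, Real.norm_eq_abs, abs_of_nonpos (by linarith [hs.2])]
          linarith
    _ < 1 / 2 := by nlinarith [hs.1]

theorem IsTurningPoint.mem_disc {σ : ℝ} (hσ : σ = 1 ∨ σ = -1) {p : ℂ}
    (hp : IsTurningPoint σ p) : p ∈ disc :=
  mem_disc_iff.2 (by linarith [hp.norm_sub_half_le hσ])

/-- The positive factor s does not affect the argument, and Im(p(1 - sp)) = Im p · (1 - 2s Re p)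
stays away from 0 up to s = 0 because Re p is near 4/10 < 1/2. -/
theorem IsTurningPoint.le_im_log_add_log {σ : ℝ} (hσ : σ = 1 ∨ σ = -1) {p : ℂ}
    (hp : IsTurningPoint σ p) {s : ℝ} (hs : s ∈ Set.Ioc 0 1) :
    3 / 200 ≤ σ * (Complex.log (s * p) + Complex.log (1 - s * p)).im := by
  have hd := mul_mem_disc hs (hp.mem_disc hσ)
  rw [log_add_log_of_re_pos (re_pos_of_mem_disc hd) (re_pos_of_mem_disc (one_sub_mem_disc hd)),
    Complex.log_im, mul_assoc, Complex.arg_real_mul _ hs.1]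
  apply le_mul_arg hσ (by norm_num)
  · rw [norm_mul]
    nlinarith [norm_lt_one_of_mem_disc (hp.mem_disc hσ),
      norm_lt_one_of_mem_disc (one_sub_mem_disc hd), norm_nonneg p, norm_nonneg (1 - s * p)]
  · have e : (p * (1 - s * p)).im = p.im * (1 - 2 * s * p.re) := by
      simp [Complex.mul_im, Complex.mul_re]; ring
    obtain ⟨h1, h2⟩ := hp.bounds
    rw [abs_le] at h1 h2
    have h3 : 995 / 10000 ≤ σ * p.im := by
      rcases hσ with rfl | rfl <;> linarith [h2.1, h2.2]
    have h4 : 198 / 1000 ≤ 1 - 2 * s * p.re := by nlinarith [hs.1, hs.2, h1.1, h1.2]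
    rw [e, ← mul_assoc]
    nlinarith

/-- Of the margin 0.015, at most 0.0015 is lost to log(1 - wt) and 0.003 to the phase at c. -/
theorem IsSaddle.le_im_phase_sub {w c : ℂ} (h : IsSaddle w c) {σ : ℝ} (hσ : σ = 1 ∨ σ = -1)
    {t : ℂ} (ht : t ∈ disc) (hl : 3 / 200 ≤ σ * (Complex.log t + Complex.log (1 - t)).im) :
    1 / 100 ≤ σ * (phase w t - phase w c).im := by
  have h1 := abs_le.1 h.abs_im_phase_self_le
  have hwt := norm_mul_le_of_mem_disc h.small ht
  have h2 := Complex.norm_log_one_add_half_le_self (z := -(w * t)) (by rw [norm_neg]; linarith)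
  rw [norm_neg, ← sub_eq_add_neg] at h2
  have h3 := abs_le.1 ((Complex.abs_im_le_norm (Complex.log (1 - w * t))).trans
    (h2.trans (show _ ≤ (15 / 10000 : ℝ) by linarith)))
  have e : (phase w t - phase w c).im = (Complex.log t + Complex.log (1 - t)).im -
      (Complex.log (1 - w * t)).im - (phase w c).im := by
    rw [Complex.sub_im, phase, Complex.sub_im]
  rw [e]
  rcases hσ with rfl | rfl <;> linarith [h1.1, h1.2, h3.1, h3.2]

/-! ### The phase on the middle leg of the contour -/

theorem norm_one_sub_mul_I_le {σ : ℝ} (hσ : σ = 1 ∨ σ = -1) : ‖1 - σ * Complex.I‖ ≤ 3 / 2 := by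
  have h : ‖1 - σ * Complex.I‖ ^ 2 = 2 := by
    rw [Complex.sq_norm, Complex.normSq_apply]
    rcases hσ with rfl | rfl <;> simp <;> norm_num
  nlinarith [norm_nonneg (1 - σ * Complex.I)]

namespace IsSaddle

variable {w c : ℂ}

theorem six_le_re (h : IsSaddle w c) : 6 ≤ (2 / (c * (1 - c))).re := by
  have h1 := h.norm_mul_one_sub_sub_le
  have h2 := h.le_norm_mul_one_sub
  have h3 : ‖8 - 2 / (c * (1 - c))‖ ≤ 1 := by
    have : 8 - 2 / (c * (1 - c)) = 8 * (c * (1 - c) - 1 / 4) / (c * (1 - c)) := by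
      have := h.mul_one_sub_ne_zero
      rw [eq_div_iff this, sub_mul, div_mul_cancel₀ _ this]; ring
    rw [this, norm_div, norm_mul 8, div_le_one (by linarith), Complex.norm_ofNat]
    linarith
  have h4 := (Complex.re_le_norm _).trans h3
  rw [Complex.sub_re, Complex.re_ofNat] at h4
  linarith

theorem norm_sq_mul_le (h : IsSaddle w c) : ‖c ^ 2 * w‖ ≤ 1 / 3000 := by
  rw [norm_mul, norm_pow]
  have h1 : ‖c‖ ^ 2 ≤ 1 / 3 := by nlinarith [h.norm_le, norm_nonneg c]
  calc ‖c‖ ^ 2 * ‖w‖ ≤ 1 / 3 * (1 / 1000) := by gcongr; exact h.small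
    _ = 1 / 3000 := by norm_num

theorem norm_cubic_coeff_le (h : IsSaddle w c) {σ : ℝ} (hσ : σ = 1 ∨ σ = -1) :
    ‖-2 * (c ^ 2 * w) * (1 - σ * Complex.I) / (c * (1 - c)) ^ 2‖ ≤ 1 := by
  have h1 := h.le_norm_mul_one_sub
  rw [norm_div, norm_mul, norm_mul (-2), norm_pow _ 2, norm_neg, Complex.norm_ofNat,
    div_le_one (by positivity)]
  nlinarith [h.norm_sq_mul_le, norm_one_sub_mul_I_le hσ, norm_nonneg (c ^ 2 * w),
    norm_nonneg (1 - σ * Complex.I)]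

/-- With D = c(1-c), ε = c²w and τ = ωx, the denominator c²(1-wt) equals Q = D - ετ. The cubic term
comes only from expanding 1/Q about 1/D. Replacing log(1-u) by -u costs 50x⁴, which is at most 5|x|³
for |x| ≤ 1/10; the truncation of 1/Q accounts for the remaining unit in 6 and 51. -/
theorem mid_bounds (h : IsSaddle w c) {σ : ℝ} (hσ : σ = 1 ∨ σ = -1) {x : ℝ}
    (hx : x ∈ Set.Icc (-(1 / 10)) (1 / 10)) {φ : ℂ}
    (hφ : φ = σ * Complex.I * (phase w (c + (1 - σ * Complex.I) * x) - phase w c)) :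
    ‖φ + 2 / (c * (1 - c)) * x ^ 2‖ ≤ 6 * |x| ^ 3 ∧
    ‖φ + 2 / (c * (1 - c)) * x ^ 2
      - -2 * (c ^ 2 * w) * (1 - σ * Complex.I) / (c * (1 - c)) ^ 2 * x ^ 3‖ ≤ 51 * x ^ 4 := by
  have hσ2 : (σ : ℂ) ^ 2 = 1 := by rcases hσ with rfl | rfl <;> simp
  have hxa : |x| ≤ 1 / 10 := abs_le.2 hx
  have hx0 := abs_nonneg x
  have hω := norm_one_sub_mul_I_le hσ
  set ω : ℂ := 1 - σ * Complex.I with hωdef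
  have hω2 : ω ^ 2 = -2 * σ * Complex.I := by
    rw [hωdef]; linear_combination hσ2 * Complex.I ^ 2 + Complex.I_sq
  set τ : ℂ := ω * x with hτdef
  have hτ : ‖τ‖ ≤ 3 / 2 * |x| := by
    rw [hτdef, norm_mul, Complex.norm_real, Real.norm_eq_abs]; gcongr
  have hD := h.le_norm_mul_one_sub
  have hD0 := h.mul_one_sub_ne_zero
  set D : ℂ := c * (1 - c) with hDdef
  have hε := h.norm_sq_mul_le
  set ε : ℂ := c ^ 2 * w with hεdef
  have hετ : ‖ε * τ‖ ≤ 1 / 2000 * |x| := by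
    rw [norm_mul]
    calc ‖ε‖ * ‖τ‖ ≤ 1 / 3000 * (3 / 2 * |x|) := by gcongr
      _ = _ := by ring
  set Q : ℂ := D - ε * τ with hQdef
  have hQ : 23 / 100 ≤ ‖Q‖ := by
    have := norm_sub_norm_le D (ε * τ)
    rw [← hQdef] at this
    linarith
  have hQ0 : Q ≠ 0 := norm_pos_iff.1 (by linarith)
  have hQe : c ^ 2 * (1 - w * (c + τ)) = Q := by
    rw [hQdef, hDdef, hεdef]; linear_combination (-c) * h.eqn
  have hph := h.phase_eq (t := c + τ) (by rw [add_sub_cancel_left]; linarith)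
  rw [add_sub_cancel_left, hQe, ← h.phase_self] at hph
  set u : ℂ := τ ^ 2 / Q with hudef
  have hu : ‖u‖ ≤ 9 * x ^ 2 := by
    rw [hudef, hτdef, mul_pow, hω2, norm_div, div_le_iff₀ (by linarith)]
    have : ‖-2 * (σ : ℂ) * Complex.I * (x : ℂ) ^ 2‖ = 2 * x ^ 2 := by
      rcases hσ with rfl | rfl <;> simp
    rw [this]
    nlinarith [sq_nonneg x]
  have hx2 : x ^ 2 ≤ 1 / 100 := by rw [← sq_abs]; nlinarith
  have hlog : ‖Complex.log (1 - u) + u‖ ≤ 50 * x ^ 4 := by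
    have h1 := Complex.norm_log_one_add_sub_self_le (z := -u) (by rw [norm_neg]; linarith)
    rw [norm_neg, ← sub_eq_add_neg, sub_neg_eq_add] at h1
    have h2 : (1 - ‖u‖)⁻¹ ≤ 10 / 9 := by
      rw [inv_le_comm₀ (by linarith) (by norm_num)]; linarith
    have h3 : 0 ≤ (1 - ‖u‖)⁻¹ := inv_nonneg.2 (by linarith)
    calc _ ≤ ‖u‖ ^ 2 * (1 - ‖u‖)⁻¹ / 2 := h1
      _ ≤ (9 * x ^ 2) ^ 2 * (10 / 9) / 2 := by gcongr
      _ ≤ 50 * x ^ 4 := by nlinarith [sq_nonneg (x ^ 2)]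
  have hlog' : ‖(σ : ℂ) * Complex.I * (Complex.log (1 - u) + u)‖ ≤ 50 * x ^ 4 := by
    rw [norm_mul]
    have : ‖(σ : ℂ) * Complex.I‖ = 1 := by rcases hσ with rfl | rfl <;> simp
    rw [this, one_mul]; exact hlog
  have hσu : σ * Complex.I * u = 2 * x ^ 2 / Q := by
    rw [hudef, hτdef, mul_pow, hω2]
    linear_combination (-2 * (x : ℂ) ^ 2 / Q * Complex.I ^ 2) * hσ2 - 2 * x ^ 2 / Q * Complex.I_sq
  have hφ' : φ = σ * Complex.I * (Complex.log (1 - u) + u) - 2 * x ^ 2 / Q := by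
    rw [hφ, hph]; linear_combination -hσu
  have e1 : φ + 2 / D * x ^ 2 =
      σ * Complex.I * (Complex.log (1 - u) + u) - 2 * x ^ 2 * (ε * τ) / (Q * D) := by
    have : 2 * (x : ℂ) ^ 2 * (ε * τ) / (Q * D) = 2 * x ^ 2 / Q - 2 / D * x ^ 2 := by
      have : ε * τ = D - Q := by rw [hQdef]; ring
      rw [this]; field_simp
    rw [hφ', this]; ring
  have e2 : φ + 2 / D * x ^ 2 - -2 * ε * ω / D ^ 2 * x ^ 3 =
      σ * Complex.I * (Complex.log (1 - u) + u) - 2 * x ^ 2 * (ε * τ) ^ 2 / (Q * D ^ 2) := by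
    have h1 : 2 * (x : ℂ) ^ 2 * (ε * τ) ^ 2 / (Q * D ^ 2) =
        2 * x ^ 2 * (ε * τ) / (Q * D) - 2 * x ^ 2 * (ε * τ) / D ^ 2 := by
      have h2 : 2 * (x : ℂ) ^ 2 * (ε * τ) ^ 2 = 2 * x ^ 2 * (ε * τ) * (D - Q) := by
        rw [hQdef]; ring
      rw [h2]; field_simp
    have h3 : -2 * ε * ω / D ^ 2 * x ^ 3 = -(2 * x ^ 2 * (ε * τ) / D ^ 2) := by
      rw [hτdef]; ring
    rw [e1, h1, h3]; ring
  have hx3 : |x| ^ 3 = |x| * x ^ 2 := by rw [← sq_abs]; ring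
  have hx4 : x ^ 4 = |x| * |x| * x ^ 2 := by rw [← sq, sq_abs]; ring
  have hx2n : ‖(2 * (x : ℂ) ^ 2)‖ = 2 * x ^ 2 := by simp
  constructor
  · rw [e1]
    have h1 : ‖2 * (x : ℂ) ^ 2 * (ε * τ) / (Q * D)‖ ≤ |x| ^ 3 := by
      rw [norm_div, norm_mul, norm_mul Q, hx2n, div_le_iff₀ (by positivity), hx3]
      have h5 : 5 / 100 ≤ ‖Q‖ * ‖D‖ := by nlinarith
      calc 2 * x ^ 2 * ‖ε * τ‖ ≤ 2 * x ^ 2 * (1 / 2000 * |x|) := by gcongr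
        _ = |x| * x ^ 2 * (1 / 1000) := by ring
        _ ≤ |x| * x ^ 2 * (‖Q‖ * ‖D‖) := by gcongr; linarith
    have h2 : 50 * x ^ 4 ≤ 5 * |x| ^ 3 := by
      rw [hx3, hx4]
      have : 0 ≤ |x| * x ^ 2 := by positivity
      nlinarith
    linarith [norm_sub_le ((σ : ℂ) * Complex.I * (Complex.log (1 - u) + u))
      (2 * (x : ℂ) ^ 2 * (ε * τ) / (Q * D))]
  · rw [e2]
    have h1 : ‖2 * (x : ℂ) ^ 2 * (ε * τ) ^ 2 / (Q * D ^ 2)‖ ≤ x ^ 4 := by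
      rw [norm_div, norm_mul, norm_mul Q, norm_pow _ 2, norm_pow D, hx2n,
        div_le_iff₀ (by positivity), hx4]
      have h5 : 1 / 100 ≤ ‖Q‖ * ‖D‖ ^ 2 := by
        calc (1 / 100 : ℝ) ≤ 23 / 100 * (24 / 100) ^ 2 := by norm_num
          _ ≤ _ := by gcongr
      calc 2 * x ^ 2 * ‖ε * τ‖ ^ 2 ≤ 2 * x ^ 2 * (1 / 2000 * |x|) ^ 2 := by gcongr
        _ = |x| * |x| * x ^ 2 * (1 / 2000000) := by ring
        _ ≤ |x| * |x| * x ^ 2 * (‖Q‖ * ‖D‖ ^ 2) := by gcongr; linarith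
    linarith [norm_sub_le ((σ : ℂ) * Complex.I * (Complex.log (1 - u) + u))
      (2 * (x : ℂ) ^ 2 * (ε * τ) ^ 2 / (Q * D ^ 2))]

end IsSaddle

/-! ### Deformation of the contour -/

/-- `Φ` is bounded by `a s ^ e + b` at `s p`, uniformly in `s ∈ (0, 1]` and `p` near `1/2`. -/
def LegBound (Φ : ℂ → ℂ) (a e b : ℝ) : Prop :=
  ∀ p : ℂ, ‖p - 1 / 2‖ ≤ 1 / 4 → ∀ s ∈ Set.Ioc (0 : ℝ) 1, ‖Φ (s * p)‖ ≤ a * s ^ e + b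

theorem mem_disc_of_norm_le {p : ℂ} (hp : ‖p - 1 / 2‖ ≤ 1 / 4) : p ∈ disc :=
  mem_disc_iff.2 (by linarith)

theorem LegBound.intervalIntegrable {Φ : ℂ → ℂ} {a e b : ℝ} (h : LegBound Φ a e b) (he : -1 < e)
    (hΦ : ContinuousOn Φ disc) {p : ℂ} (hp : ‖p - 1 / 2‖ ≤ 1 / 4) :
    IntervalIntegrable (fun s : ℝ => Φ (s * p)) MeasureTheory.volume 0 1 := by
  have hdom : IntervalIntegrable (fun s : ℝ => a * s ^ e + b) MeasureTheory.volume 0 1 :=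
    ((intervalIntegral.intervalIntegrable_rpow' he).const_mul a).add intervalIntegrable_const
  refine hdom.mono_fun' ?_ ?_
  · rw [Set.uIoc_of_le zero_le_one]
    refine ContinuousOn.aestronglyMeasurable ?_ measurableSet_Ioc
    exact hΦ.comp (by fun_prop) fun s hs => mul_mem_disc hs (mem_disc_of_norm_le hp)
  · rw [Set.uIoc_of_le zero_le_one]
    exact (MeasureTheory.ae_restrict_iff' measurableSet_Ioc).2
      (Eventually.of_forall fun s hs => h p hp s hs)

theorem LegBound.norm_integral_le {Φ : ℂ → ℂ} {a e b : ℝ} (he : -1 < e)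
    {p : ℂ} (h : ∀ s ∈ Set.Ioc (0 : ℝ) 1, ‖Φ (s * p)‖ ≤ a * s ^ e + b) :
    ‖∫ s in (0 : ℝ)..1, Φ (s * p)‖ ≤ a / (e + 1) + b := by
  have hdom : IntervalIntegrable (fun s : ℝ => s ^ e) MeasureTheory.volume 0 1 :=
    intervalIntegral.intervalIntegrable_rpow' he
  have h1 := intervalIntegral.norm_integral_le_of_norm_le (μ := MeasureTheory.volume)
    (f := fun s : ℝ => Φ (s * p)) zero_le_one
    (Eventually.of_forall h) ((hdom.const_mul a).add intervalIntegrable_const)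
  refine h1.trans_eq ?_
  rw [intervalIntegral.integral_add (hdom.const_mul a) intervalIntegrable_const,
    intervalIntegral.integral_const_mul, integral_rpow (Or.inl he)]
  simp [Real.zero_rpow (show e + 1 ≠ 0 by linarith)]
  ring

/-- This is the fundamental theorem of calculus on [εp, p], followed by ε → 0 using integrability up
to the end point. -/
theorem tendsto_primitive_ray {Φ H : ℂ → ℂ} (hH : ∀ z ∈ disc, HasDerivAt H (Φ z) z)
    {p : ℂ} (hp : p ∈ disc)
    (hint : IntervalIntegrable (fun s : ℝ => Φ (s * p)) MeasureTheory.volume 0 1) :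
    Tendsto (fun ε : ℝ => H (ε * p)) (𝓝[>] 0)
      (𝓝 (H p - p * ∫ s in (0 : ℝ)..1, Φ (s * p))) := by
  have hcont : ContinuousOn (fun ε : ℝ => ∫ s in ε..1, Φ (s * p)) (Set.uIcc 0 1) :=
    intervalIntegral.continuousOn_primitive_interval_left
      (by rw [Set.uIcc_of_le zero_le_one]
          exact (intervalIntegrable_iff_integrableOn_Icc_of_le zero_le_one).1 hint)
  have h0 : Tendsto (fun ε : ℝ => ∫ s in ε..1, Φ (s * p)) (𝓝[>] 0)
      (𝓝 (∫ s in (0 : ℝ)..1, Φ (s * p))) := by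
    have := hcont 0 (by simp)
    rw [Set.uIcc_of_le zero_le_one] at this
    refine this.tendsto.mono_left ?_
    rw [← nhdsWithin_Ioo_eq_nhdsGT (zero_lt_one' ℝ)]
    exact nhdsWithin_mono _ Set.Ioo_subset_Icc_self
  refine (((h0.const_mul p).const_sub (H p))).congr' ?_
  filter_upwards [Ioo_mem_nhdsGT (zero_lt_one' ℝ)] with ε hε
  have hmem : ∀ s ∈ Set.uIcc ε 1, s ∈ Set.Ioc (0 : ℝ) 1 := fun s hs => by
    rw [Set.uIcc_of_le hε.2.le] at hs
    exact ⟨hε.1.trans_le hs.1, hs.2⟩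
  have hd : ∀ s ∈ Set.uIcc ε 1, HasDerivAt (fun s : ℝ => H (s * p)) (p * Φ (s * p)) s := by
    intro s hs
    have h1 := hH _ (mul_mem_disc (hmem s hs) hp)
    have h2 : HasDerivAt (fun s : ℝ => (s : ℂ) * p) p s := by
      simpa using (Complex.ofRealCLM.hasDerivAt (x := s)).mul_const p
    exact (h1.comp s h2).congr_deriv (by ring)
  have hint' : IntervalIntegrable (fun s : ℝ => p * Φ (s * p)) MeasureTheory.volume ε 1 :=
    (hint.mono_set (by
      rw [Set.uIcc_of_le hε.2.le, Set.uIcc_of_le zero_le_one]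
      exact Set.Icc_subset_Icc_left hε.1.le)).const_mul p
  have := intervalIntegral.integral_eq_sub_of_hasDerivAt hd hint'
  rw [intervalIntegral.integral_const_mul] at this
  rw [this]
  simp

/-- A primitive of `Φ` has a limit at the end point `0` which does not depend on the direction. -/
theorem LegBound.exists_limit {Φ H : ℂ → ℂ} {a e b : ℝ} (h : LegBound Φ a e b) (he : -1 < e)
    (hΦ : ContinuousOn Φ disc) (hH : ∀ z ∈ disc, HasDerivAt H (Φ z) z) :
    ∃ L : ℂ, ∀ p : ℂ, ‖p - 1 / 2‖ ≤ 1 / 4 → p * ∫ s in (0 : ℝ)..1, Φ (s * p) = H p - L := by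
  have hhalf : ‖(1 / 2 : ℂ) - 1 / 2‖ ≤ 1 / 4 := by simp
  refine ⟨H (1 / 2) - 1 / 2 * ∫ s in (0 : ℝ)..1, Φ (s * (1 / 2)), fun p hp => ?_⟩
  have t1 := tendsto_primitive_ray hH (mem_disc_of_norm_le hp) (h.intervalIntegrable he hΦ hp)
  have t2 := tendsto_primitive_ray hH (mem_disc_of_norm_le hhalf)
    (h.intervalIntegrable he hΦ hhalf)
  have hbound : ∀ᶠ ε : ℝ in 𝓝[>] 0, ‖H (ε * p) - H (ε * (1 / 2))‖ ≤ a * ε ^ (e + 1) + b * ε := by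
    filter_upwards [Ioo_mem_nhdsGT (zero_lt_one' ℝ)] with ε hε
    have hs : ε ∈ Set.Ioc (0 : ℝ) 1 := ⟨hε.1, hε.2.le⟩
    have hconv : Convex ℝ (Metric.closedBall (1 / 2 : ℂ) (1 / 4)) := convex_closedBall _ _
    -- The mean value inequality on the ball shrunk towards 0 by the factor ε bounds the difference
    -- between two rays by (aε^e + b)ε, which tends to 0 as e > -1.
    have hmv := hconv.norm_image_sub_le_of_norm_hasDerivWithin_le
      (f := fun z => H (ε * z)) (f' := fun z => Φ (ε * z) * ε) (C := (a * ε ^ e + b) * ε)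
      (x := 1 / 2) (y := p)
      (fun z hz => by
        rw [Metric.mem_closedBall, dist_eq_norm] at hz
        have h1 := hH _ (mul_mem_disc hs (mem_disc_of_norm_le hz))
        have h2 : HasDerivAt (fun z : ℂ => (ε : ℂ) * z) ε z := by
          simpa using (hasDerivAt_id z).const_mul (ε : ℂ)
        exact (h1.comp z h2).hasDerivWithinAt)
      (fun z hz => by
        rw [Metric.mem_closedBall, dist_eq_norm] at hz
        rw [norm_mul, Complex.norm_real, Real.norm_of_nonneg hε.1.le]
        exact mul_le_mul_of_nonneg_right (h z hz ε hs) hε.1.le)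
      (by simp) (by rw [Metric.mem_closedBall, dist_eq_norm]; exact hp)
    have hnn : 0 ≤ (a * ε ^ e + b) * ε :=
      mul_nonneg ((norm_nonneg _).trans (h p hp ε hs)) hε.1.le
    calc _ ≤ (a * ε ^ e + b) * ε * ‖p - 1 / 2‖ := hmv
      _ ≤ (a * ε ^ e + b) * ε * 1 := by gcongr; linarith
      _ = a * ε ^ (e + 1) + b * ε := by rw [Real.rpow_add_one hε.1.ne']; ring
  have hz : Tendsto (fun ε : ℝ => a * ε ^ (e + 1) + b * ε) (𝓝[>] 0) (𝓝 0) := by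
    have h1 : Tendsto (fun ε : ℝ => ε ^ (e + 1)) (𝓝 0) (𝓝 0) := by
      have := (Real.continuousAt_rpow_const 0 (e + 1) (Or.inr (by linarith))).tendsto
      rwa [Real.zero_rpow (by linarith)] at this
    have := (h1.const_mul a).add ((tendsto_id (x := 𝓝 (0 : ℝ))).const_mul b)
    simp only [mul_zero, add_zero, id] at this
    exact this.mono_left nhdsWithin_le_nhds
  have t3 := squeeze_zero_norm' hbound hz
  have := tendsto_nhds_unique t3 (t1.sub t2)
  linear_combination this

/-- The integral over `[0, 1]` as an integral over a broken line with vertices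
`0`, `c - r ω`, `c + r ω`, `1`. -/
theorem integral_eq_legs {Φ : ℂ → ℂ} {a₀ e₀ b₀ a₁ e₁ b₁ : ℝ} (hΦ : DifferentiableOn ℂ Φ disc)
    (h₀ : LegBound Φ a₀ e₀ b₀) (h₁ : LegBound (fun t => Φ (1 - t)) a₁ e₁ b₁) (he₀ : -1 < e₀)
    (he₁ : -1 < e₁) {c ω : ℂ} {r : ℝ} (hr : 0 ≤ r)
    (hp₀ : ‖c - ω * r - 1 / 2‖ ≤ 1 / 4) (hp₁ : ‖1 - (c + ω * r) - 1 / 2‖ ≤ 1 / 4)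
    (hmid : ∀ x ∈ Set.Icc (-r) r, c + ω * x ∈ disc) :
    IntervalIntegrable (fun x : ℝ => Φ x) MeasureTheory.volume 0 1 ∧
    ∫ x in (0 : ℝ)..1, Φ x =
      (c - ω * r) * (∫ s in (0 : ℝ)..1, Φ (s * (c - ω * r))) +
      ω * (∫ x in (-r)..r, Φ (c + ω * x)) +
      (1 - (c + ω * r)) * (∫ s in (0 : ℝ)..1, Φ (1 - s * (1 - (c + ω * r)))) := by
  obtain ⟨H, hH⟩ := hΦ.isExactOn_ball
  -- The end point 1 is treated as the end point 0 of the reflected function.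
  have hH1 : ∀ z ∈ disc, HasDerivAt (fun z => -H (1 - z)) ((fun t => Φ (1 - t)) z) z := by
    intro z hz
    have h1 := hH _ (one_sub_mem_disc hz)
    have h2 : HasDerivAt (fun z : ℂ => 1 - z) (-1) z := by
      simpa using (hasDerivAt_id z).const_sub (1 : ℂ)
    exact (h1.comp z h2).neg.congr_deriv (by simp)
  have hc := hΦ.continuousOn
  have hc1 : ContinuousOn (fun t => Φ (1 - t)) disc :=
    hc.comp (by fun_prop) fun t ht => one_sub_mem_disc ht
  obtain ⟨L₀, hL₀⟩ := h₀.exists_limit he₀ hc hH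
  obtain ⟨L₁, hL₁⟩ := h₁.exists_limit he₁ hc1 hH1
  have hhalf : ‖(1 / 2 : ℂ) - 1 / 2‖ ≤ 1 / 4 := by simp
  have i₀ : IntervalIntegrable (fun x : ℝ => Φ x) MeasureTheory.volume 0 (1 / 2) := by
    have := (h₀.intervalIntegrable he₀ hc hhalf).comp_mul_left (c := 2)
    simpa [mul_comm] using this
  have i₁ : IntervalIntegrable (fun x : ℝ => Φ x) MeasureTheory.volume (1 / 2) 1 := by
    have := ((h₁.intervalIntegrable he₁ hc1 hhalf).comp_mul_left (c := 2)).comp_sub_left 1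
    refine IntervalIntegrable.symm ?_
    convert this using 1
    · funext x
      congr 1
      push_cast
      ring
    · norm_num
    · norm_num
  refine ⟨i₀.trans i₁, ?_⟩
  rw [← intervalIntegral.integral_add_adjacent_intervals i₀ i₁]
  have j₀ : ∫ x in (0 : ℝ)..(1 / 2), Φ x = H (1 / 2) - L₀ := by
    rw [← hL₀ _ hhalf]
    have := intervalIntegral.integral_comp_mul_right (a := 0) (b := 1) (fun x : ℝ => Φ x)
      (c := 1 / 2) (by norm_num)
    push_cast at this
    rw [this]
    simp
  have j₁ : ∫ x in (1 / 2 : ℝ)..1, Φ x = -H (1 - 1 / 2) - L₁ := by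
    rw [← hL₁ _ hhalf]
    have := intervalIntegral.integral_comp_mul_right (a := 0) (b := 1)
      (fun x : ℝ => Φ ((1 - x : ℝ) : ℂ)) (c := 1 / 2) (by norm_num)
    rw [intervalIntegral.integral_comp_sub_left (fun x : ℝ => Φ x)] at this
    push_cast at this
    rw [this]
    norm_num
    ring
  have jm : ω * (∫ x in (-r)..r, Φ (c + ω * x)) = H (c + ω * r) - H (c - ω * r) := by
    rw [← intervalIntegral.integral_const_mul]
    have hrr : -r ≤ r := by linarith
    have hd : ∀ x ∈ Set.uIcc (-r) r,
        HasDerivAt (fun x : ℝ => H (c + ω * x)) (ω * Φ (c + ω * x)) x := by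
      intro x hx
      rw [Set.uIcc_of_le hrr] at hx
      have h1 := hH _ (hmid x hx)
      have h2 : HasDerivAt (fun s : ℝ => c + ω * (s : ℂ)) ω x := by
        simpa using ((Complex.ofRealCLM.hasDerivAt (x := x)).const_mul ω).const_add c
      exact (h1.comp x h2).congr_deriv (by ring)
    rw [intervalIntegral.integral_eq_sub_of_hasDerivAt hd]
    · push_cast; ring_nf
    · refine ContinuousOn.intervalIntegrable ?_
      rw [Set.uIcc_of_le hrr]
      exact continuousOn_const.mul (hc.comp (by fun_prop) hmid)
  rw [j₀, j₁, jm, hL₀ _ hp₀, hL₁ _ hp₁, sub_sub_cancel]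
  norm_num
  ring

/-! ### The saddle point estimate -/

/-- The bounds on an amplitude on which the error term depends. -/
structure IsBounded (c₀ c₁ A₀ A₁ ρ : ℝ) (K : ℝ → ℝ) (f : ℂ → ℂ) : Prop where
  differentiableOn : DifferentiableOn ℂ f disc
  bounded : ∀ r : ℝ, 0 < r → r < 1 / 2 → ∀ t ∈ Metric.closedBall (1 / 2 : ℂ) r, ‖f t‖ ≤ K r
  at_zero : ∀ t ∈ disc, ‖t‖ < ρ → ‖f t‖ ≤ A₀ * ‖t‖ ^ c₀
  at_one : ∀ t ∈ disc, ‖1 - t‖ < ρ → ‖f t‖ ≤ A₁ * ‖1 - t‖ ^ c₁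

theorem IsBounded.reflect {c₀ c₁ A₀ A₁ ρ : ℝ} {K : ℝ → ℝ} {f : ℂ → ℂ}
    (h : IsBounded c₀ c₁ A₀ A₁ ρ K f) : IsBounded c₁ c₀ A₁ A₀ ρ K fun t => f (1 - t) where
  differentiableOn := h.differentiableOn.comp (by fun_prop) fun t ht => one_sub_mem_disc ht
  bounded r h0 h1 t ht := h.bounded r h0 h1 _ (by
    rw [Metric.mem_closedBall, dist_eq_norm] at ht ⊢
    rwa [show 1 - t - 1 / 2 = -(t - 1 / 2) by ring, norm_neg])
  at_zero t ht h1 := by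
    simpa using h.at_one (1 - t) (one_sub_mem_disc ht) (by simpa using h1)
  at_one t ht h1 := h.at_zero (1 - t) (one_sub_mem_disc ht) h1

/-- Near 0 the constant 4 bounds |p|^c₀, since 1/4 ≤ |p| < 1 and c₀ > -1. Otherwise s ≥ min(ρ, 1),
and sp is within 1/2 - s/4 of the centre, which fixes the radius at which K is evaluated. -/
theorem IsBounded.legBound {c₀ c₁ A₀ A₁ ρ : ℝ} {K : ℝ → ℝ} {f : ℂ → ℂ}
    (h : IsBounded c₀ c₁ A₀ A₁ ρ K f) (hc₀ : -1 < c₀) (hρ : 0 < ρ) :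
    LegBound f (4 * |A₀|) c₀ |K (1 / 2 - min ρ 1 / 4)| := by
  intro p hp s hs
  have hpd := mem_disc_of_norm_le hp
  have hsd := mul_mem_disc hs hpd
  have hp1 := norm_lt_one_of_mem_disc hpd
  have hsn : ‖(s : ℂ) * p‖ = s * ‖p‖ := by
    rw [norm_mul, Complex.norm_real, Real.norm_of_nonneg hs.1.le]
  have hspow : 0 ≤ s ^ c₀ := Real.rpow_nonneg hs.1.le _
  by_cases hlt : ‖(s : ℂ) * p‖ < ρ
  · have h4 : 1 / 4 ≤ ‖p‖ := by
      have h1 := norm_sub_norm_le (1 / 2 : ℂ) p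
      rw [norm_sub_rev] at h1
      have h2 : ‖(1 / 2 : ℂ)‖ = 1 / 2 := by norm_num
      linarith
    have hpp : ‖p‖ ^ c₀ ≤ 4 := by
      calc ‖p‖ ^ c₀ ≤ ‖p‖ ^ (-1 : ℝ) :=
            Real.rpow_le_rpow_of_exponent_ge (by linarith) hp1.le hc₀.le
        _ = ‖p‖⁻¹ := Real.rpow_neg_one _
        _ ≤ 4 := by rw [inv_le_comm₀ (by linarith) (by norm_num)]; linarith
    calc ‖f (s * p)‖ ≤ A₀ * ‖(s : ℂ) * p‖ ^ c₀ := h.at_zero _ hsd hlt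
      _ ≤ |A₀| * (s ^ c₀ * ‖p‖ ^ c₀) := by
          rw [hsn, Real.mul_rpow hs.1.le (norm_nonneg _)]
          gcongr
          exact le_abs_self _
      _ ≤ |A₀| * (s ^ c₀ * 4) := by gcongr
      _ = 4 * |A₀| * s ^ c₀ := by ring
      _ ≤ _ := le_add_of_nonneg_right (abs_nonneg _)
  · have hρs : min ρ 1 ≤ s := by
      refine (min_le_left _ _).trans ((not_lt.1 hlt).trans ?_)
      rw [hsn]; nlinarith [hs.1, norm_nonneg p]
    have hmin : 0 < min ρ 1 := lt_min hρ one_pos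
    have hmin1 : min ρ 1 ≤ 1 := min_le_right _ _
    have hb := h.bounded (1 / 2 - min ρ 1 / 4) (by linarith) (by linarith) (s * p) (by
      rw [Metric.mem_closedBall, dist_eq_norm]
      calc ‖(s : ℂ) * p - 1 / 2‖ = ‖(s : ℂ) * (p - 1 / 2) + ((s - 1) / 2 : ℝ)‖ := by
            congr 1; push_cast; ring
        _ ≤ s * ‖p - 1 / 2‖ + (1 - s) / 2 := by
            refine norm_add_le_of_le ?_ ?_
            · rw [norm_mul, Complex.norm_real, Real.norm_of_nonneg hs.1.le]
            · rw [Complex.norm_real, Real.norm_eq_abs, abs_of_nonpos (by linarith [hs.2])]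
              linarith
        _ ≤ _ := by nlinarith [hs.1])
    calc ‖f (s * p)‖ ≤ |K (1 / 2 - min ρ 1 / 4)| := hb.trans (le_abs_self _)
      _ ≤ _ := le_add_of_nonneg_left (by positivity)

theorem norm_exp_phase (w t : ℂ) (κ : ℝ) :
    ‖Complex.exp (κ * (Complex.I * phase w t))‖ = Real.exp (-(κ * (phase w t).im)) := by
  rw [Complex.norm_exp, Complex.re_ofReal_mul, Complex.I_mul_re]
  ring_nf

/-- A crude bound growing with |κ|; it serves only to justify the deformation of the contour and
does not enter the error constant. -/
theorem norm_exp_phase_le {w t : ℂ} (hw : ‖w‖ ≤ 1 / 1000) (ht : t ∈ disc) (κ : ℝ) :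
    ‖Complex.exp (κ * (Complex.I * phase w t))‖ ≤ Real.exp (|κ| * (2 * Real.pi)) := by
  rw [norm_exp_phase]
  apply Real.exp_le_exp.2
  have h1 := Complex.abs_arg_lt_pi_div_two_iff.2 (Or.inl (re_pos_of_mem_disc ht))
  have h2 := Complex.abs_arg_lt_pi_div_two_iff.2
    (Or.inl (re_pos_of_mem_disc (one_sub_mem_disc ht)))
  have h3 := Complex.abs_arg_lt_pi_div_two_iff.2 (Or.inl (re_one_sub_mul_pos hw ht))
  have h4 : |(phase w t).im| ≤ 2 * Real.pi := by
    have e : (phase w t).im = t.arg + (1 - t).arg - (1 - w * t).arg := by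
      simp [phase, Complex.log_im]
    rw [abs_lt] at h1 h2 h3
    rw [e, abs_le]
    constructor <;> linarith [h1.1, h1.2, h2.1, h2.2, h3.1, h3.2, Real.pi_pos]
  calc -(κ * (phase w t).im) ≤ |κ * (phase w t).im| := neg_le_abs _
    _ = |κ| * |(phase w t).im| := abs_mul _ _
    _ ≤ _ := by gcongr

theorem LegBound.mul {f g : ℂ → ℂ} {a e b B : ℝ} (h : LegBound f a e b)
    (hg : ∀ t ∈ disc, ‖g t‖ ≤ B) : LegBound (fun t => f t * g t) (a * B) e (b * B) := by
  intro p hp s hs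
  have h1 := h p hp s hs
  have h2 := hg _ (mul_mem_disc hs (mem_disc_of_norm_le hp))
  rw [norm_mul]
  calc _ ≤ (a * s ^ e + b) * B := mul_le_mul h1 h2 (norm_nonneg _) ((norm_nonneg _).trans h1)
    _ = _ := by ring

theorem exp_neg_div_le {x : ℝ} (hx : 1 ≤ x) :
    Real.exp (-(x / 100)) ≤ 20000 * (1 / x * √(1 / x)) := by
  have h1 := Real.quadratic_le_exp_of_nonneg (show 0 ≤ x / 100 by positivity)
  have h2 : x ^ 2 / 20000 ≤ Real.exp (x / 100) := by nlinarith
  have h3 : 1 / x ≤ √(1 / x) := by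
    apply Real.le_sqrt_of_sq_le
    have : 1 / x ≤ 1 := by rw [div_le_one (by linarith)]; exact hx
    have h0 : 0 ≤ 1 / x := by positivity
    nlinarith
  rw [Real.exp_neg]
  calc (Real.exp (x / 100))⁻¹ ≤ (x ^ 2 / 20000)⁻¹ := by gcongr
    _ = 20000 * (1 / x * (1 / x)) := by field_simp
    _ ≤ _ := by gcongr

/-- The legs of the contour next to the end points contribute little. -/
theorem norm_leg_le {w c p : ℂ} (h : IsSaddle w c) {σ κ : ℝ} (hσ : σ = 1 ∨ σ = -1)
    (hκ : κ = σ * |κ|) (hκ1 : 1 ≤ |κ|) (hp : IsTurningPoint σ p) {f G : ℂ → ℂ} {a e b : ℝ}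
    (he : -1 < e) (hf : LegBound f a e b)
    (hG : ∀ s ∈ Set.Ioc (0 : ℝ) 1, ∃ t ∈ disc,
      3 / 200 ≤ σ * (Complex.log t + Complex.log (1 - t)).im ∧
      G (s * p) = Complex.exp (κ * (Complex.I * phase w t))) :
    ‖p * ∫ s in (0 : ℝ)..1, f (s * p) * G (s * p)‖ ≤
      20000 * (a / (e + 1) + b) * ‖Complex.exp (κ * (Complex.I * phase w c))‖ *
        (1 / |κ| * √(1 / |κ|)) := by
  have hp4 := hp.norm_sub_half_le hσ
  set N := ‖Complex.exp (κ * (Complex.I * phase w c))‖ with hN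
  set X := N * Real.exp (-(|κ| / 100)) with hX
  have hX0 : 0 < X := mul_pos (norm_pos_iff.2 (Complex.exp_ne_zero _)) (Real.exp_pos _)
  have hGb : ∀ s ∈ Set.Ioc (0 : ℝ) 1, ‖G (s * p)‖ ≤ X := by
    intro s hs
    obtain ⟨t, ht, hl, hGt⟩ := hG s hs
    have h1 := h.le_im_phase_sub hσ ht hl
    rw [hGt, norm_exp_phase, hX, hN, norm_exp_phase, ← Real.exp_add]
    apply Real.exp_le_exp.2
    rw [Complex.sub_im] at h1
    have h2 : κ * (phase w t).im - κ * (phase w c).im =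
        |κ| * (σ * ((phase w t).im - (phase w c).im)) := by
      conv_lhs => rw [hκ]
      ring
    nlinarith
  have hb : ∀ s ∈ Set.Ioc (0 : ℝ) 1, ‖(fun t => f t * G t) (s * p)‖ ≤ a * X * s ^ e + b * X := by
    intro s hs
    have h1 := hf p hp4 s hs
    rw [norm_mul]
    calc _ ≤ (a * s ^ e + b) * X :=
          mul_le_mul h1 (hGb s hs) (norm_nonneg _) ((norm_nonneg _).trans h1)
      _ = _ := by ring
  have h1 := LegBound.norm_integral_le (Φ := fun t => f t * G t) he hb
  have hp1 := norm_lt_one_of_mem_disc (hp.mem_disc hσ)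
  -- The signs of a and b are not assumed; nonnegativity is read off from the bound on the integral.
  have hnn : 0 ≤ a / (e + 1) + b := by
    have h2 : (a * X / (e + 1) + b * X) = (a / (e + 1) + b) * X := by ring
    rw [h2] at h1
    exact nonneg_of_mul_nonneg_left ((norm_nonneg _).trans h1) hX0
  rw [norm_mul]
  calc _ ≤ 1 * (a * X / (e + 1) + b * X) :=
        mul_le_mul hp1.le h1 (norm_nonneg _) zero_le_one
    _ = (a / (e + 1) + b) * N * Real.exp (-(|κ| / 100)) := by rw [hX]; ring
    _ ≤ (a / (e + 1) + b) * N * (20000 * (1 / |κ| * √(1 / |κ|))) := by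
        gcongr; exact exp_neg_div_le hκ1
    _ = _ := by ring

/-- The leg through the saddle point. -/
theorem norm_middle_leg_sub_le {w c : ℂ} (h : IsSaddle w c) {σ κ k : ℝ} (hσ : σ = 1 ∨ σ = -1)
    (hκ : κ = σ * |κ|) (hκ1 : 1 ≤ |κ|) {f : ℂ → ℂ} (hf : DifferentiableOn ℂ f disc)
    (hk : ∀ t ∈ Metric.closedBall (1 / 2 : ℂ) (3 / 8), ‖f t‖ ≤ k) :
    ‖(1 - σ * Complex.I) * (∫ x in (-(1 / 10) : ℝ)..(1 / 10),
        f (c + (1 - σ * Complex.I) * x) *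
          Complex.exp (κ * (Complex.I * phase w (c + (1 - σ * Complex.I) * x)))) -
      Complex.exp (κ * (Complex.I * phase w c)) * f c *
        (2 * Real.pi / (κ * (2 * Complex.I / (c * (1 - c))))) ^ (1 / 2 : ℂ)‖ ≤
      2000 * k * ‖Complex.exp (κ * (Complex.I * phase w c))‖ * (1 / |κ| * √(1 / |κ|)) := by
  have hpb := h.norm_cubic_coeff_le hσ
  have hωn := norm_one_sub_mul_I_le hσ
  have hmb := fun (x : ℝ) (hx : x ∈ Set.Icc (-(1 / 10) : ℝ) (1 / 10)) => h.mid_bounds hσ hx rfl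
  -- The factor ω from dt = ω dx merges with the Gaussian root into the principal root of the
  -- statement, because c(1-c) is in the right half plane.
  have hsqrt : (1 - σ * Complex.I) * (Real.pi / (|κ| * (2 / (c * (1 - c))))) ^ (1 / 2 : ℂ) =
      (2 * Real.pi / (κ * (2 * Complex.I / (c * (1 - c))))) ^ (1 / 2 : ℂ) := by
    have hD0 := h.mul_one_sub_ne_zero
    have hκ0 : ((|κ| : ℝ) : ℂ) ≠ 0 := by
      have : |κ| ≠ 0 := by linarith
      exact_mod_cast this
    have hDre : 0 < (c * (1 - c)).re := by
      have h1 := (Complex.abs_re_le_norm _).trans h.norm_mul_one_sub_sub_le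
      have e : (c * (1 - c) - 1 / 4).re = (c * (1 - c)).re - 1 / 4 := by
        rw [Complex.sub_re]; norm_num
      rw [e] at h1
      linarith [(abs_le.1 h1).1]
    have e : (Real.pi / (|κ| * (2 / (c * (1 - c)))) : ℂ) =
        ((Real.pi / (2 * |κ|) : ℝ) : ℂ) * (c * (1 - c)) := by
      push_cast; field_simp
    rw [mul_cpow_half_of_re_pos hσ]
    · congr 1
      have hκc : (κ : ℂ) = σ * (|κ| : ℝ) := by exact_mod_cast congrArg Complex.ofReal hκ
      have hσ2 : (σ : ℂ) ^ 2 = 1 := by rcases hσ with rfl | rfl <;> simp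
      have hσ0 : (σ : ℂ) ≠ 0 := fun h0 => by simp [h0] at hσ2
      rw [hκc]
      field_simp
      linear_combination (-(c * (1 - c)) * Complex.I ^ 2) * hσ2 - c * (1 - c) * Complex.I_sq
    · rw [e, Complex.re_ofReal_mul]
      have := Real.pi_pos
      positivity
  set ω : ℂ := 1 - σ * Complex.I with hω
  set q : ℂ := 2 / (c * (1 - c)) with hq
  set p : ℂ := -2 * (c ^ 2 * w) * ω / (c * (1 - c)) ^ 2 with hp
  set E : ℂ := Complex.exp (κ * (Complex.I * phase w c)) with hE
  set φ : ℝ → ℂ := fun x => σ * Complex.I * (phase w (c + ω * x) - phase w c) with hφ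
  have hball : Metric.ball c (1 / 4) ⊆ Metric.closedBall (1 / 2 : ℂ) (3 / 8) := by
    intro t ht
    rw [Metric.mem_ball, dist_eq_norm] at ht
    rw [Metric.mem_closedBall, dist_eq_norm]
    calc ‖t - 1 / 2‖ = ‖(t - c) + (c - 1 / 2)‖ := by ring_nf
      _ ≤ ‖t - c‖ + ‖c - 1 / 2‖ := norm_add_le _ _
      _ ≤ 3 / 8 := by linarith [h.near]
  have hballd : Metric.ball c (1 / 4) ⊆ disc := fun t ht => by
    have := hball ht
    rw [Metric.mem_closedBall, dist_eq_norm] at this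
    exact mem_disc_iff.2 (by linarith)
  have hτ : ∀ x ∈ Set.Icc (-(1 / 10) : ℝ) (1 / 10), ‖ω * x‖ ≤ 3 / 2 * |x| ∧
      c + ω * x ∈ Metric.ball c (1 / 4) := by
    intro x hx
    have h1 : ‖ω * x‖ ≤ 3 / 2 * |x| := by
      rw [norm_mul, Complex.norm_real, Real.norm_eq_abs]; gcongr
    refine ⟨h1, ?_⟩
    rw [Metric.mem_ball, dist_eq_norm, add_sub_cancel_left]
    linarith [abs_le.2 hx]
  have hk0 : 0 ≤ k := (norm_nonneg _).trans (hk _ (hball (Metric.mem_ball_self (by norm_num))))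
  obtain ⟨hd1, hd2⟩ := norm_sub_sub_deriv_le (by norm_num) (hf.mono hballd)
    fun t ht => hk t (hball ht)
  have hf1 : ‖ω * deriv f c‖ ≤ 12 * k := by
    rw [norm_mul]
    calc ‖ω‖ * ‖deriv f c‖ ≤ 3 / 2 * (2 * k / (1 / 4)) := by gcongr
      _ = 12 * k := by ring
  have hmaps : Set.MapsTo (fun x : ℝ => c + ω * x) (Set.Icc (-(1 / 10) : ℝ) (1 / 10)) disc :=
    fun x hx => hballd (hτ x hx).2
  have hκpos : 0 < |κ| := by linarith
  -- Taylor's estimate on radius 1/4 with |ω| ≤ 3/2 gives |f₁| ≤ 12k and a quadratic remainder of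
  -- 64k · (9/4)x² = 144k x².
  have hlocal := norm_integral_sub_gaussian_le (r := 1 / 10) (κ := |κ|) (b₀ := k) (b₁ := 2 * k)
    (B := 144 * k) (P₃ := 6) (P₄ := 51) (h := fun x => f (c + ω * x)) (φ := φ) (f₀ := f c)
    (f₁ := ω * deriv f c) (q := q) (p := p) (by norm_num) hκpos
    (hk _ (hball (Metric.mem_ball_self (by norm_num)))) (by linarith)
    (by rw [norm_mul]
        calc _ ≤ 12 * k * 1 := by gcongr
          _ ≤ 144 * k := by linarith) h.six_le_re
    (hf.continuousOn.comp (by fun_prop) hmaps)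
    (continuousOn_const.mul (((differentiableOn_phase h.small).continuousOn.comp
      (by fun_prop) hmaps).sub continuousOn_const))
    (fun x hx => by
      have h1 := hd2 _ (hτ x hx).2
      rw [add_sub_cancel_left] at h1
      rw [show ω * deriv f c * x = deriv f c * (ω * x) by ring]
      refine h1.trans ?_
      calc 4 * k / (1 / 4) ^ 2 * ‖ω * x‖ ^ 2 ≤ 4 * k / (1 / 4) ^ 2 * (3 / 2 * |x|) ^ 2 := by
            gcongr; exact (hτ x hx).1
        _ = 144 * k * x ^ 2 := by rw [mul_pow, sq_abs]; ring)
    (fun x hx => by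
      refine (hmb x hx).1.trans ?_
      have := abs_le.2 hx
      rw [← sq_abs x]
      nlinarith [sq_nonneg |x|])
    (fun x hx => (hmb x hx).1) (fun x hx => (hmb x hx).2)
  have hfac : ∫ x in (-(1 / 10) : ℝ)..(1 / 10), f (c + ω * x) *
        Complex.exp (κ * (Complex.I * phase w (c + ω * x))) =
      E * ∫ x in (-(1 / 10) : ℝ)..(1 / 10), f (c + ω * x) * Complex.exp (|κ| * φ x) := by
    rw [← intervalIntegral.integral_const_mul]
    congr 1
    funext x
    have : Complex.exp (κ * (Complex.I * phase w (c + ω * x))) = E * Complex.exp (|κ| * φ x) := by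
      have hκc : (κ : ℂ) = σ * (|κ| : ℝ) := by exact_mod_cast congrArg Complex.ofReal hκ
      rw [hE, ← Complex.exp_add, hφ]
      congr 1
      linear_combination (Complex.I * (phase w (c + ω * x) - phase w c)) * hκc
    rw [this]; ring
  have hpi : √(Real.pi / |κ|) ≤ 2 * √(1 / |κ|) := by
    rw [show Real.pi / |κ| = Real.pi * (1 / |κ|) by ring, Real.sqrt_mul Real.pi_pos.le]
    gcongr
    rw [Real.sqrt_le_left (by norm_num)]
    linarith [Real.pi_lt_four]
  rw [hfac, ← hsqrt]
  set J := ∫ x in (-(1 / 10) : ℝ)..(1 / 10), f (c + ω * x) * Complex.exp (|κ| * φ x)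
  set Z := (Real.pi / (|κ| * q)) ^ (1 / 2 : ℂ)
  rw [show ω * (E * J) - E * f c * (ω * Z) = E * ω * (J - f c * Z) by ring, norm_mul, norm_mul]
  calc ‖E‖ * ‖ω‖ * ‖J - f c * Z‖ ≤ ‖E‖ * (3 / 2) *
        ((2 * (144 * k) + (k + 2 * k) * (6 ^ 2 + 51) + k / (1 / 10) ^ 2) / |κ| *
          (2 * √(1 / |κ|))) := by
        gcongr
        exact hlocal.trans (by gcongr)
    _ = 1947 * (k * ‖E‖ * (1 / |κ| * √(1 / |κ|))) := by ring
    _ ≤ 2000 * (k * ‖E‖ * (1 / |κ| * √(1 / |κ|))) := by gcongr; norm_num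
    _ = _ := by ring

theorem exists_saddle_estimate {c₀ c₁ ρ : ℝ} (A₀ A₁ : ℝ) (K : ℝ → ℝ) (hc₀ : -1 < c₀) (hc₁ : -1 < c₁)
    (hρ : 0 < ρ) : ∃ C : ℝ, 0 < C ∧ ∀ w c : ℂ, IsSaddle w c → ∀ κ : ℝ, 1 ≤ |κ| →
      ∀ f : ℂ → ℂ, IsBounded c₀ c₁ A₀ A₁ ρ K f →
      IntervalIntegrable (fun t : ℝ => f t * Complex.exp (κ * (Complex.I * phase w t)))
        MeasureTheory.volume 0 1 ∧
      ‖(∫ t in (0 : ℝ)..1, f t * Complex.exp (κ * (Complex.I * phase w t))) -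
        Complex.exp (κ * (Complex.I * phase w c)) * f c *
          (2 * Real.pi / (κ * (2 * Complex.I / (c * (1 - c))))) ^ (1 / 2 : ℂ)‖ ≤
        C * ‖Complex.exp (κ * (Complex.I * phase w c))‖ * (1 / |κ| * √(1 / |κ|)) := by
  set b := |K (1 / 2 - min ρ 1 / 4)| with hb
  refine ⟨20000 * (4 * |A₀| / (c₀ + 1) + b) + 2000 * |K (3 / 8)| +
    20000 * (4 * |A₁| / (c₁ + 1) + b) + 1, ?_, ?_⟩
  · have : 0 < c₀ + 1 := by linarith
    have : 0 < c₁ + 1 := by linarith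
    positivity
  intro w c h κ hκ1 f hf
  obtain ⟨σ, hσ, hκ⟩ : ∃ σ : ℝ, (σ = 1 ∨ σ = -1) ∧ κ = σ * |κ| := by
    rcases abs_cases κ with ⟨h1, -⟩ | ⟨h1, -⟩
    · exact ⟨1, Or.inl rfl, by rw [h1]; ring⟩
    · exact ⟨-1, Or.inr rfl, by rw [h1]; ring⟩
  set ω : ℂ := 1 - σ * Complex.I with hω
  have hl₀ := hf.legBound hc₀ hρ
  have hl₁ := hf.reflect.legBound hc₁ hρ
  have hE : ∀ t ∈ disc, ‖Complex.exp (κ * (Complex.I * phase w t))‖ ≤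
      Real.exp (|κ| * (2 * Real.pi)) := fun t ht => norm_exp_phase_le h.small ht κ
  have hL₀ := hl₀.mul hE
  have hL₁ := hl₁.mul (g := fun t => Complex.exp (κ * (Complex.I * phase w (1 - t))))
    fun t ht => hE _ (one_sub_mem_disc ht)
  have hdiff : DifferentiableOn ℂ (fun t => f t * Complex.exp (κ * (Complex.I * phase w t))) disc :=
    hf.differentiableOn.mul (((differentiableOn_phase h.small).const_mul _).const_mul _).cexp
  have hp₀ : IsTurningPoint σ (c - ω * (1 / 10 : ℝ)) := by
    have := h.isTurningPoint σ
    rw [← hω] at this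
    convert this using 2
    push_cast; ring
  have hp₁ : IsTurningPoint σ (1 - (c + ω * (1 / 10 : ℝ))) := by
    have := h.isTurningPoint_one_sub σ
    rw [← hω] at this
    convert this using 3
    push_cast; ring
  have hmid : ∀ x ∈ Set.Icc (-(1 / 10) : ℝ) (1 / 10), c + ω * x ∈ disc := by
    intro x hx
    rw [mem_disc_iff]
    calc ‖c + ω * x - 1 / 2‖ = ‖(c - 1 / 2) + ω * x‖ := by ring_nf
      _ ≤ 1 / 2000 + 3 / 2 * (1 / 10) := by
          refine norm_add_le_of_le h.near ?_
          rw [norm_mul, Complex.norm_real, Real.norm_eq_abs]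
          gcongr
          · exact norm_one_sub_mul_I_le hσ
          · exact abs_le.2 hx
      _ < 1 / 2 := by norm_num
  obtain ⟨hint, heq⟩ := integral_eq_legs (c := c) (ω := ω) (r := 1 / 10) hdiff hL₀ hL₁ hc₀ hc₁
    (by norm_num) (hp₀.norm_sub_half_le hσ) (hp₁.norm_sub_half_le hσ) hmid
  refine ⟨hint, ?_⟩
  rw [heq]
  set N := ‖Complex.exp (κ * (Complex.I * phase w c))‖ with hN
  set Y := 1 / |κ| * √(1 / |κ|) with hY
  have B₀ := norm_leg_le h hσ hκ hκ1 hp₀ hc₀ hl₀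
    (G := fun t => Complex.exp (κ * (Complex.I * phase w t)))
    (fun s hs => ⟨_, mul_mem_disc hs (hp₀.mem_disc hσ), hp₀.le_im_log_add_log hσ hs, rfl⟩)
  have B₁ := norm_leg_le h hσ hκ hκ1 hp₁ hc₁ hl₁
    (G := fun t => Complex.exp (κ * (Complex.I * phase w (1 - t))))
    (fun s hs => ⟨_, one_sub_mem_disc (mul_mem_disc hs (hp₁.mem_disc hσ)), by
      rw [sub_sub_cancel, add_comm]; exact hp₁.le_im_log_add_log hσ hs, rfl⟩)
  have Bm := norm_middle_leg_sub_le h hσ hκ hκ1 hf.differentiableOn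
    (k := |K (3 / 8)|) fun t ht =>
      (hf.bounded (3 / 8) (by norm_num) (by norm_num) t ht).trans (le_abs_self _)
  rw [← hω] at Bm
  rw [← hN, ← hY] at B₀ B₁ Bm
  have hNY : 0 ≤ N * Y := by positivity
  have key : ∀ x y z v : ℂ, ‖x + y + z - v‖ ≤ ‖x‖ + ‖y - v‖ + ‖z‖ := fun x y z v => by
    rw [show x + y + z - v = x + (y - v) + z by ring]
    exact norm_add₃_le
  refine (key _ _ _ _).trans ((add_le_add (add_le_add B₀ Bm) B₁).trans ?_)
  linarith

theorem IsAdmissible.isBounded {M ε c₀ c₁ A₀ A₁ ρ m : ℝ} {K : ℝ → ℝ} {F : ℂ → ℂ → ℂ → ℂ}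
    (h : IsAdmissible M ε c₀ c₁ A₀ A₁ ρ m K F) {η lam : ℂ} (hη : η ∈ OmegaPlus M)
    (hlam : lam ∈ puncturedDisc ε) :
    IsBounded c₀ c₁ A₀ A₁ ρ K fun t => F t η lam where
  differentiableOn := (h.analytic η hη lam hlam).differentiableOn
  bounded r h0 h1 t ht := h.bounded r h0 h1 t ht η hη lam hlam
  at_zero t ht h1 := h.at_zero t ht h1 η hη lam hlam
  at_one t ht h1 := h.at_one t ht h1 η hη lam hlam

end SaddlePoint

theorem mainTheorem9 :
    ∃ M₀ : ℝ, 0 < M₀ ∧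
      ∀ (c₀ c₁ A₀ A₁ ρ m : ℝ) (K : ℝ → ℝ), -1 < c₀ → -1 < c₁ → 0 < ρ → 0 < m →
        ∃ C δ : ℝ, 0 < C ∧ 0 < δ ∧
          ∀ (M ε : ℝ), M₀ ≤ M → 0 < ε →
            ∀ F : ℂ → ℂ → ℂ → ℂ, SaddlePoint.IsAdmissible M ε c₀ c₁ A₀ A₁ ρ m K F →
              ∀ η ∈ SaddlePoint.OmegaPlus M,
                ∀ lam ∈ SaddlePoint.puncturedDisc ε, ‖lam‖ < δ →
                  ∀ α : ℂ, SaddlePoint.IsValueOfA lam α →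
                    IntervalIntegrable (SaddlePoint.integrand F η lam α)
                      MeasureTheory.volume 0 1 ∧
                    ∃ E : ℂ, ‖E‖ ≤ C * (M ^ 2 / |α.im|) ∧
                      ∫ t in (0 : ℝ)..1, SaddlePoint.integrand F η lam α t =
                        SaddlePoint.saddleContribution F η lam α * (1 + E) := by
  refine ⟨1000, by norm_num, fun c₀ c₁ A₀ A₁ ρ m K hc₀ hc₁ hρ hm => ?_⟩
  obtain ⟨C, hC, hest⟩ := SaddlePoint.exists_saddle_estimate A₀ A₁ K hc₀ hc₁ hρ
  refine ⟨2 * C / m, Real.exp (-4) / 2, by positivity, by positivity, ?_⟩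
  intro M ε hM _ F hF η hη lam hlam hlamδ α hα
  have hκ1 := SaddlePoint.one_le_abs_im_of_isValueOfA hlam.2 hlamδ hα
  have hsad := SaddlePoint.isSaddle_tMinus hM hη
  set κ := α.im with hκ
  set c := SaddlePoint.tMinus η with hc
  obtain ⟨hint, hbound⟩ := hest _ _ hsad κ hκ1 _ (hF.isBounded hη hlam)
  have hexp : ∀ t : ℂ, Complex.exp (-(κ : ℂ) * SaddlePoint.S η t) =
      Complex.exp (κ * (Complex.I * SaddlePoint.phase η⁻¹ t)) := fun t => by
    rw [SaddlePoint.S_eq_phase]; congr 1; ring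
  have hfun : SaddlePoint.integrand F η lam α = fun t : ℝ => F t η lam *
      Complex.exp (κ * (Complex.I * SaddlePoint.phase η⁻¹ t)) := by
    funext t
    rw [SaddlePoint.integrand, ← hκ, hexp]
  have hcontr : SaddlePoint.saddleContribution F η lam α =
      Complex.exp (κ * (Complex.I * SaddlePoint.phase η⁻¹ c)) * F c η lam *
        (2 * Real.pi / (κ * (2 * Complex.I / (c * (1 - c))))) ^ (1 / 2 : ℂ) := by
    rw [SaddlePoint.saddleContribution, ← hκ, ← hc, hexp, hsad.deriv_two_S]
  rw [hfun, hcontr]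
  refine ⟨hint, ?_⟩
  set e := Complex.exp (κ * (Complex.I * SaddlePoint.phase η⁻¹ c)) with he
  set R := (2 * Real.pi / (κ * (2 * Complex.I / (c * (1 - c))))) ^ (1 / 2 : ℂ) with hR
  set J := ∫ t in (0 : ℝ)..1, F t η lam *
    Complex.exp (κ * (Complex.I * SaddlePoint.phase η⁻¹ t)) with hJ
  have hκpos : 0 < |κ| := by linarith
  -- The lower bound of the same order |κ|^(-1/2) as in the absolute error is what turns it into a
  -- relative error; its factor 1/2 gives the 2 in 2C/m.
  have hRn : 1 / 2 * √(1 / |κ|) ≤ ‖R‖ := by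
    have h1 : ‖R‖ ^ 2 = Real.pi * ‖c * (1 - c)‖ / |κ| := by
      rw [← norm_pow, hR, SaddlePoint.cpow_half_sq, norm_div, norm_mul, norm_mul, norm_div,
        norm_mul 2 Complex.I, Complex.norm_real, Complex.norm_real, Complex.norm_I,
        Complex.norm_ofNat, Real.norm_eq_abs, Real.norm_eq_abs, abs_of_pos Real.pi_pos]
      field_simp
    have h2 : 1 / 4 * (1 / |κ|) ≤ ‖R‖ ^ 2 := by
      rw [h1, mul_one_div]
      gcongr
      nlinarith [Real.pi_gt_three, hsad.le_norm_mul_one_sub]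
    refine le_of_sq_le_sq ?_ (norm_nonneg _)
    rw [mul_pow, Real.sq_sqrt (by positivity)]
    linarith
  have he0 : 0 < ‖e‖ := norm_pos_iff.2 (Complex.exp_ne_zero _)
  have hs0 : 0 < √(1 / |κ|) := Real.sqrt_pos.2 (by positivity)
  have hR0 : 0 < ‖R‖ := lt_of_lt_of_le (by positivity) hRn
  have hFm := hF.separated η hη lam hlam
  rw [← hc] at hFm
  have hF0 : 0 < ‖F c η lam‖ := by linarith
  have hZ0 : e * F c η lam * R ≠ 0 :=
    mul_ne_zero (mul_ne_zero (norm_pos_iff.1 he0) (norm_pos_iff.1 hF0)) (norm_pos_iff.1 hR0)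
  refine ⟨(J - e * F c η lam * R) / (e * F c η lam * R), ?_, ?_⟩
  · rw [norm_div, div_le_iff₀ (norm_pos_iff.2 hZ0), norm_mul, norm_mul]
    refine hbound.trans ?_
    -- The estimate already holds without the factor M², which is inserted here.
    have hM2 : 1 ≤ M ^ 2 := by nlinarith
    calc C * ‖e‖ * (1 / |κ| * √(1 / |κ|))
        = 2 * C / m * (1 / |κ|) * (‖e‖ * m * (1 / 2 * √(1 / |κ|))) := by field_simp
      _ ≤ 2 * C / m * (M ^ 2 / |κ|) * (‖e‖ * ‖F c η lam‖ * ‖R‖) := by gcongr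
  · rw [mul_add, mul_one, mul_div_cancel₀ _ hZ0]
    ring
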